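/- **Lemma 2.3 (Self-adjointness).** Let $V:\mathbb{R}^3\to\mathbb{R}$ be a measurable function in the Kato class, that is, $$\lim_{r\to0+}\ \sup_{x\in\mathbb{R}^3}\int_{|x-y|\leq r}\frac{|V(y)|}{|x-y|}\,dy=0,$$ and let $\mathcal{H}u:=-\Delta u+Vu$, in the sense of distributions, for $u\in H^1(\mathbb{R}^3)$ (complex-valued); here $Vu$ is a tempered distribution for every $u\in H^1$. Write $q(u,u)=\|\nabla u\|_{L^2}^2+\int_{\mathbb{R}^3}V|u|^2dx$. Then for all sufficiently large $a\in\mathbb{R}$ (depending on $V$) one has, for every $u\in H^1$, that $V|u|^2$ is integrable and $$\tfrac12\|\nabla u\|_{L^2}^2-a\|u\|_{L^2}^2\leq q(u,u)\leq\tfrac32\|\nabla u\|_{L^2}^2+a\|u\|_{L^2}^2. \qquad (*)$$ Moreover, for every $a\in\mathbb{R}$ such that $(*)$ holds for all $u\in H^1$: 1. $\mathcal{H}+a+1$ is a bijection from $H^1$ onto $H^{-1}$, so that $\mathfrak{H}^2:=(\mathcal{H}+a+1)^{-1}(L^2)=\{u\in H^1:\ (\mathcal{H}+a+1)u\in L^2\}$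 is well defined; 2. $u\mapsto\mathcal{H}u$ with domain $\mathfrak{H}^2$ is a self-adjoint operator on $L^2(\mathbb{R}^3)$. -/

import Mathlib

namespace Schrodinger

open MeasureTheory Filter Topology
open scoped SchwartzMap LineDeriv Laplacian ENNReal

noncomputable section

/-- Euclidean space `ℝ³`. -/
abbrev R3 : Type := EuclideanSpace ℝ (Fin 3)

/-- The complex Hilbert space `L²(ℝ³)`. -/
abbrev L2 : Type := Lp ℂ 2 (volume : Measure R3)

/-- The Kato class: real-valued measurable `V` on `ℝ³` with
`lim_{r → 0+} sup_x ∫_{|x - y| ≤ r} |V y| / |x - y| dy = 0`. The integral and the supremum are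
taken in `[0, ∞]`; the convergence to `0` forces them to be finite for small `r`. -/
def KatoClass (V : R3 → ℝ) : Prop :=
  AEMeasurable V (volume : Measure R3) ∧
    Tendsto (fun r : ℝ => ⨆ x : R3, ∫⁻ y in Metric.closedBall x r, ‖V y‖ₑ / ‖x - y‖ₑ)
      (𝓝[>] 0) (𝓝 0)

/-- An `L²` function regarded as a tempered distribution. -/
def toDist (u : L2) : 𝓢'(R3, ℂ) := Lp.toTemperedDistribution u

/-- The Sobolev space `H¹(ℝ³)`, as a subset of `L²(ℝ³)`. -/
def H1 : Set L2 := {u | TemperedDistribution.MemSobolev 1 2 (toDist u)}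

/-- The Sobolev space `H⁻¹(ℝ³)`. -/
def Hneg1 : Set 𝓢'(R3, ℂ) := {T | TemperedDistribution.MemSobolev (-1) 2 T}

/-- `g = (g₁, g₂, g₃)` is the distributional gradient of `u`. -/
def HasGradient (u : L2) (g : Fin 3 → L2) : Prop :=
  ∀ i, ∂_{EuclideanSpace.single i (1 : ℝ)} (toDist u) = toDist (g i)

/-- `T` is the regular tempered distribution `φ ↦ ∫ φ w` given by the function `w`. -/
def IsRegular (w : R3 → ℂ) (T : 𝓢'(R3, ℂ)) : Prop :=
  ∀ φ : 𝓢(R3, ℂ), Integrable (fun x => φ x * w x) ∧ T φ = ∫ x, φ x * w x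

open Classical in
/-- The function `w` regarded as a tempered distribution (`0` if it does not define one). -/
def regular (w : R3 → ℂ) : 𝓢'(R3, ℂ) :=
  if h : ∃ T, IsRegular w T then h.choose else 0

/-- The function `V u`. -/
def potential (V : R3 → ℝ) (u : L2) : R3 → ℂ := fun x => (V x : ℂ) * u x

/-- The distribution `𝓗 u = -Δ u + V u`. -/
def hamiltonian (V : R3 → ℝ) (u : L2) : 𝓢'(R3, ℂ) :=
  -Δ (toDist u) + regular (potential V u)

/-- The distribution `(𝓗 + a + 1) u`. -/
def shifted (V : R3 → ℝ) (a : ℝ) (u : L2) : 𝓢'(R3, ℂ) :=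
  hamiltonian V u + ((a : ℂ) + 1) • toDist u

/-- The two-sided bound
`½ ‖∇u‖² - a ‖u‖² ≤ q(u, u) ≤ (3/2) ‖∇u‖² + a ‖u‖²` on `H¹` for the quadratic form
`q(u, u) = ∫ u conj(𝓗 u) = ‖∇u‖² + ∫ V |u|²`. -/
def FormBound (V : R3 → ℝ) (a : ℝ) : Prop :=
  ∀ u ∈ H1, ∀ g : Fin 3 → L2, HasGradient u g →
    Integrable (fun x => V x * ‖u x‖ ^ 2) ∧
    1 / 2 * (∑ i, ‖g i‖ ^ 2) - a * ‖u‖ ^ 2 ≤ (∑ i, ‖g i‖ ^ 2) + (∫ x, V x * ‖u x‖ ^ 2) ∧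
    (∑ i, ‖g i‖ ^ 2) + (∫ x, V x * ‖u x‖ ^ 2) ≤ 3 / 2 * (∑ i, ‖g i‖ ^ 2) + a * ‖u‖ ^ 2

/-- `𝔥² = (𝓗 + a + 1)⁻¹(L²)`, the set of those `u ∈ H¹` for which `(𝓗 + a + 1) u`, a priori a
distribution, is in `L²`. -/
def h2 (V : R3 → ℝ) (a : ℝ) : Set L2 := {u | u ∈ H1 ∧ shifted V a u ∈ Set.range toDist}

end

end Schrodinger

/-!
In dimension three the kernel of `(-Δ + l)⁻¹` is at most `1 / (4π|x - y|)` and concentrates near the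
diagonal as `l → ∞`, so for `V` in the Kato class `sup_x ∫ G_l(x - y) |V y| dy → 0`. By the Schur
test `|V|^{1/2} (-Δ + l)⁻¹ |V|^{1/2}` is then small on `L²`, and by duality so is
`|V|^{1/2} (-Δ + l)^{-1/2}`; this is the form bound.

The rest uses only the form bound. Let `R` be the Fourier multiplier with symbol
`(1 + |ξ|²)^{-1/2}`, an isomorphism from `L²` onto `H¹`. The form of `𝓗 + a + 1` becomes, through
`R`, a bounded self-adjoint coercive operator `B` on `L²`, so `𝓗 + a + 1 = R⁻¹ B R⁻¹` is a
bijection from `H¹` onto `H⁻¹`. Its inverse restricts on `L²` to the bounded injective self-adjoint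
operator `R B⁻¹ R`, and inverses of such operators are self-adjoint.
-/

namespace Schrodinger

open MeasureTheory Filter Topology Set FourierTransform
open scoped SchwartzMap LineDeriv Laplacian ENNReal ComplexConjugate Real

noncomputable section

section HeatKernel

variable {E : Type*} [NormedAddCommGroup E] [InnerProductSpace ℝ E]

/-- The heat kernel `(4πt)^{-d/2} exp(-|z|² / 4t)` of `e^{tΔ}` in dimension `d`. -/
def heatKernel (t : ℝ) (z : E) : ℝ :=
  (4 * π * t) ^ (-(Module.finrank ℝ E : ℝ) / 2) * Real.exp (-‖z‖ ^ 2 / (4 * t))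

/-- The kernel of `(-Δ + l)⁻¹`, as the Laplace transform of the heat kernel. -/
def resolventKernel (l : ℝ) (z : E) : ℝ≥0∞ :=
  ∫⁻ t in Ioi (0 : ℝ), ENNReal.ofReal (Real.exp (-l * t) * heatKernel t z)

lemma heatKernel_nonneg {t : ℝ} (ht : 0 < t) (z : E) : 0 ≤ heatKernel t z := by
  unfold heatKernel; positivity

lemma heatKernel_neg (t : ℝ) (z : E) : heatKernel t (-z) = heatKernel t z := by
  simp only [heatKernel, norm_neg]

lemma resolventKernel_neg (l : ℝ) (z : E) : resolventKernel l (-z) = resolventKernel l z := by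
  simp only [resolventKernel, heatKernel_neg]

variable [MeasurableSpace E] [OpensMeasurableSpace E]

@[fun_prop]
lemma measurable_heatKernel : Measurable fun p : E × ℝ => heatKernel p.2 p.1 := by
  unfold heatKernel; fun_prop

@[fun_prop]
lemma measurable_resolventKernel (l : ℝ) : Measurable (resolventKernel l : E → ℝ≥0∞) := by
  have : Measurable fun p : E × ℝ => ENNReal.ofReal (Real.exp (-l * p.2) * heatKernel p.2 p.1) := by
    fun_prop
  exact this.lintegral_prod_right'

end HeatKernel

section ThreeDimensional

lemma heatKernel_R3 (t : ℝ) (z : R3) :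
    heatKernel t z = (4 * π * t) ^ (-3 / 2 : ℝ) * Real.exp (-‖z‖ ^ 2 / (4 * t)) := by
  simp [heatKernel]

lemma lintegral_rpow_mul_exp_neg_mul {a r : ℝ} (ha : 0 < a) (hr : 0 < r) :
    ∫⁻ t in Ioi (0 : ℝ), ENNReal.ofReal (t ^ (a - 1) * Real.exp (-(r * t))) =
      ENNReal.ofReal ((1 / r) ^ a * Real.Gamma a) := by
  have := Real.Gamma_pos_of_pos ha
  have hint := Real.integral_rpow_mul_exp_neg_mul_Ioi ha hr
  rw [← hint, ofReal_integral_eq_lintegral_ofReal]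
  · refine Integrable.of_integral_ne_zero ?_
    rw [hint]
    positivity
  · filter_upwards [self_mem_ae_restrict measurableSet_Ioi] with t ht
    have : 0 < t := ht
    positivity

lemma lintegral_Ioi_comp_inv (f : ℝ → ℝ≥0∞) :
    ∫⁻ t in Ioi (0 : ℝ), f t = ∫⁻ s in Ioi (0 : ℝ), ENNReal.ofReal (s ^ (-2 : ℝ)) * f s⁻¹ := by
  have himage : (fun s : ℝ => s⁻¹) '' Ioi 0 = Ioi 0 := by
    ext t
    simp only [image_inv_eq_inv, Set.mem_inv, mem_Ioi, inv_pos]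
  rw [← himage, lintegral_image_eq_lintegral_abs_deriv_mul measurableSet_Ioi
    (fun s hs => (hasDerivAt_inv (ne_of_gt hs)).hasDerivWithinAt) inv_injective.injOn, himage]
  refine setLIntegral_congr_fun measurableSet_Ioi fun s _ => ?_
  rw [abs_neg, abs_of_nonneg (by positivity), Real.rpow_neg_ofNat, zpow_neg]
  rfl

lemma lintegral_heatKernel {z : R3} (hz : z ≠ 0) :
    ∫⁻ t in Ioi (0 : ℝ), ENNReal.ofReal (heatKernel t z) = ENNReal.ofReal (1 / (4 * π * ‖z‖)) := by
  have : 0 < ‖z‖ := norm_pos_iff.mpr hz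
  have hinv : ∀ s : ℝ, 0 < s → s ^ (-2 : ℝ) * heatKernel s⁻¹ z =
      (4 * π) ^ (-3 / 2 : ℝ) * (s ^ (1 / 2 - 1 : ℝ) * Real.exp (-(‖z‖ ^ 2 / 4 * s))) := by
    intro s hs
    have hpow : s ^ (1 / 2 - 1 : ℝ) = s ^ (-2 : ℝ) * s⁻¹ ^ (-3 / 2 : ℝ) := by
      rw [← Real.rpow_neg_eq_inv_rpow, ← Real.rpow_add hs]
      norm_num
    rw [heatKernel_R3, Real.mul_rpow (by positivity) (by positivity), hpow]
    field_simp
  calc ∫⁻ t in Ioi (0 : ℝ), ENNReal.ofReal (heatKernel t z)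
      = ∫⁻ s in Ioi (0 : ℝ), ENNReal.ofReal ((4 * π) ^ (-3 / 2 : ℝ)) *
          ENNReal.ofReal (s ^ (1 / 2 - 1 : ℝ) * Real.exp (-(‖z‖ ^ 2 / 4 * s))) := by
        rw [lintegral_Ioi_comp_inv]
        refine setLIntegral_congr_fun measurableSet_Ioi fun s hs => ?_
        have hs : 0 < s := hs
        rw [← ENNReal.ofReal_mul (by positivity), ← ENNReal.ofReal_mul (by positivity), hinv s hs]
    _ = ENNReal.ofReal (1 / (4 * π * ‖z‖)) := by
        rw [lintegral_const_mul' _ _ ENNReal.ofReal_ne_top,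
          lintegral_rpow_mul_exp_neg_mul (by norm_num) (by positivity),
          ← ENNReal.ofReal_mul (by positivity), Real.Gamma_one_half_eq]
        have hzpow : (1 / (‖z‖ ^ 2 / 4)) ^ (1 / 2 : ℝ) = 2 / ‖z‖ := by
          rw [← Real.sqrt_eq_rpow, show 1 / (‖z‖ ^ 2 / 4) = (2 / ‖z‖) ^ 2 by field_simp; norm_num,
            Real.sqrt_sq (by positivity)]
        have hπpow : (4 * π) ^ (-3 / 2 : ℝ) = (4 * π * (2 * √π))⁻¹ := by
          rw [show (-3 / 2 : ℝ) = -(1 + 1 / 2) by norm_num, Real.rpow_neg (by positivity),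
            Real.rpow_add (by positivity), Real.rpow_one, ← Real.sqrt_eq_rpow,
            Real.sqrt_mul (by norm_num), show (4 : ℝ) = 2 ^ 2 by norm_num,
            Real.sqrt_sq (by norm_num)]
        rw [hzpow, hπpow]
        congr 1
        field_simp

lemma resolventKernel_le_inv {l : ℝ} (hl : 0 ≤ l) (z : R3) : resolventKernel l z ≤ ‖z‖ₑ⁻¹ := by
  rcases eq_or_ne z 0 with rfl | hz
  · simp
  have hz' : 0 < ‖z‖ := norm_pos_iff.mpr hz
  calc resolventKernel l z
      ≤ ∫⁻ t in Ioi (0 : ℝ), ENNReal.ofReal (heatKernel t z) := by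
        refine setLIntegral_mono' measurableSet_Ioi fun t ht => ENNReal.ofReal_le_ofReal ?_
        refine mul_le_of_le_one_left (heatKernel_nonneg ht z) (Real.exp_le_one_iff.mpr ?_)
        nlinarith [mem_Ioi.mp ht]
    _ = ENNReal.ofReal (1 / (4 * π * ‖z‖)) := lintegral_heatKernel hz
    _ ≤ ENNReal.ofReal ‖z‖⁻¹ := by
        refine ENNReal.ofReal_le_ofReal ?_
        rw [one_div]
        gcongr
        nlinarith [Real.pi_gt_three]
    _ = ‖z‖ₑ⁻¹ := by rw [ENNReal.ofReal_inv_of_pos hz', ofReal_norm]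

lemma heatKernel_le_rpow {t : ℝ} (ht : 0 < t) {z : R3} (hz : z ≠ 0) :
    heatKernel t z ≤ 32 / ‖z‖ ^ 4 * t ^ (1 / 2 : ℝ) := by
  have : 0 < ‖z‖ := norm_pos_iff.mpr hz
  have hpow : (4 * π * t) ^ (-3 / 2 : ℝ) ≤ t ^ (-3 / 2 : ℝ) :=
    Real.rpow_le_rpow_of_nonpos ht (by nlinarith [Real.pi_gt_three]) (by norm_num)
  have hexp : Real.exp (-‖z‖ ^ 2 / (4 * t)) ≤ 32 / ‖z‖ ^ 4 * t ^ (2 : ℝ) := by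
    calc Real.exp (-‖z‖ ^ 2 / (4 * t)) = (Real.exp (‖z‖ ^ 2 / (4 * t)))⁻¹ := by
          rw [← Real.exp_neg, neg_div]
      _ ≤ ((‖z‖ ^ 2 / (4 * t)) ^ 2 / 2)⁻¹ := by
          have hs : 0 ≤ ‖z‖ ^ 2 / (4 * t) := by positivity
          gcongr
          linarith [Real.quadratic_le_exp_of_nonneg hs]
      _ = 32 / ‖z‖ ^ 4 * t ^ (2 : ℝ) := by norm_cast; field_simp; norm_num
  calc heatKernel t z ≤ t ^ (-3 / 2 : ℝ) * (32 / ‖z‖ ^ 4 * t ^ (2 : ℝ)) := by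
        rw [heatKernel_R3]; gcongr
    _ = 32 / ‖z‖ ^ 4 * (t ^ (-3 / 2 : ℝ) * t ^ (2 : ℝ)) := by ring
    _ = 32 / ‖z‖ ^ 4 * t ^ (1 / 2 : ℝ) := by rw [← Real.rpow_add ht]; norm_num

lemma resolventKernel_le_rpow {l : ℝ} (hl : 0 < l) {z : R3} (hz : z ≠ 0) :
    resolventKernel l z ≤
      ENNReal.ofReal (32 / ‖z‖ ^ 4 * ((1 / l) ^ (3 / 2 : ℝ) * Real.Gamma (3 / 2))) := by
  calc resolventKernel l z
      ≤ ∫⁻ t in Ioi (0 : ℝ), ENNReal.ofReal (32 / ‖z‖ ^ 4) *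
          ENNReal.ofReal (t ^ (3 / 2 - 1 : ℝ) * Real.exp (-(l * t))) := by
        refine setLIntegral_mono' measurableSet_Ioi fun t ht => ?_
        rw [← ENNReal.ofReal_mul (by positivity), neg_mul]
        refine ENNReal.ofReal_le_ofReal ?_
        calc Real.exp (-(l * t)) * heatKernel t z
            ≤ Real.exp (-(l * t)) * (32 / ‖z‖ ^ 4 * t ^ (1 / 2 : ℝ)) := by
              gcongr; exact heatKernel_le_rpow ht hz
          _ = 32 / ‖z‖ ^ 4 * (t ^ (3 / 2 - 1 : ℝ) * Real.exp (-(l * t))) := by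
              rw [show (3 / 2 - 1 : ℝ) = 1 / 2 by norm_num]; ring
    _ = ENNReal.ofReal (32 / ‖z‖ ^ 4 * ((1 / l) ^ (3 / 2 : ℝ) * Real.Gamma (3 / 2))) := by
        rw [lintegral_const_mul' _ _ ENNReal.ofReal_ne_top,
          lintegral_rpow_mul_exp_neg_mul (by norm_num) hl, ← ENNReal.ofReal_mul (by positivity)]

end ThreeDimensional

section Averaging

variable {E : Type*} [NormedAddCommGroup E] [NormedSpace ℝ E] [FiniteDimensional ℝ E]
  [MeasurableSpace E] [BorelSpace E] {μ : Measure E} [μ.IsAddHaarMeasure]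

-- A weight which varies by a bounded factor on balls of radius `r` is dominated by its averages
-- over such balls, and averaging `D` amounts to averaging `W`.
lemma measure_closedBall_mul_lintegral_mul_le {W D : E → ℝ≥0∞} {c K : ℝ≥0∞} {r : ℝ}
    (hW : AEMeasurable W μ) (hD : Measurable D)
    (hslow : ∀ z, ∀ w ∈ Metric.closedBall z r, D z ≤ c * D w)
    (hK : ∀ x, ∫⁻ y in Metric.closedBall x r, W y ∂μ ≤ K) (x : E) :
    μ (Metric.closedBall 0 r) * ∫⁻ y, W y * D (x - y) ∂μ ≤ c * (∫⁻ z, D z ∂μ) * K := by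
  set N : E → E → ℝ≥0∞ := fun y => (Metric.closedBall (x - y) r).indicator fun w => c * D w
  have hNmeas : Measurable (Function.uncurry N) := by
    have hclosed : IsClosed {p : E × E | dist p.2 (x - p.1) ≤ r} :=
      isClosed_le (by fun_prop) continuous_const
    exact Measurable.indicator (f := fun p : E × E => c * D p.2) (by fun_prop)
      hclosed.measurableSet
  have hNsymm : ∀ y w, W y * N y w =
      c * D w * (Metric.closedBall (x - w) r).indicator W y := by
    intro y w
    have hmem : w ∈ Metric.closedBall (x - y) r ↔ y ∈ Metric.closedBall (x - w) r := by
      rw [mem_closedBall_iff_norm, mem_closedBall_iff_norm,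
        show w - (x - y) = y - (x - w) by abel]
    by_cases h : y ∈ Metric.closedBall (x - w) r
    · simp only [N, indicator_of_mem h, indicator_of_mem (hmem.mpr h), mul_comm]
    · simp only [N, indicator_of_notMem h, indicator_of_notMem (mt hmem.mp h), mul_zero]
  calc μ (Metric.closedBall 0 r) * ∫⁻ y, W y * D (x - y) ∂μ
      = ∫⁻ y, W y * ∫⁻ _ in Metric.closedBall (x - y) r, D (x - y) ∂μ ∂μ := by
        rw [← lintegral_const_mul' _ _ measure_closedBall_lt_top.ne]
        refine lintegral_congr fun y => ?_
        rw [setLIntegral_const, Measure.addHaar_closedBall_center μ (x - y)]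
        ring
    _ ≤ ∫⁻ y, W y * ∫⁻ w, N y w ∂μ ∂μ := by
        refine lintegral_mono fun y => mul_le_mul_right ?_ _
        rw [lintegral_indicator measurableSet_closedBall]
        exact setLIntegral_mono' measurableSet_closedBall (hslow (x - y))
    _ = ∫⁻ w, ∫⁻ y, W y * N y w ∂μ ∂μ := by
        rw [← lintegral_lintegral_swap (hW.comp_fst.mul hNmeas.aemeasurable)]
        refine lintegral_congr fun y => ?_
        rw [lintegral_const_mul _ hNmeas.of_uncurry_left]
    _ = ∫⁻ w, c * D w * ∫⁻ y in Metric.closedBall (x - w) r, W y ∂μ ∂μ := by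
        refine lintegral_congr fun w => ?_
        simp_rw [hNsymm]
        rw [lintegral_const_mul'' _ (hW.indicator measurableSet_closedBall),
          lintegral_indicator measurableSet_closedBall]
    _ ≤ ∫⁻ w, c * D w * K ∂μ := by
        gcongr with w
        exact hK _
    _ = c * (∫⁻ z, D z ∂μ) * K := by
        rw [lintegral_mul_const _ (by fun_prop), lintegral_const_mul _ hD]

lemma exists_lintegral_mul_one_add_norm_rpow_le {s r : ℝ} (hs : Module.finrank ℝ E < s)
    (hr : 0 < r) :
    ∃ C : ℝ≥0∞, C ≠ ∞ ∧ ∀ (W : E → ℝ≥0∞) (K : ℝ≥0∞), AEMeasurable W μ →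
      (∀ x, ∫⁻ y in Metric.closedBall x r, W y ∂μ ≤ K) →
      ∀ x, ∫⁻ y, W y * ENNReal.ofReal ((1 + ‖x - y‖) ^ (-s)) ∂μ ≤ C * K := by
  have : 0 < s := (Nat.cast_nonneg _).trans_lt hs
  set D : E → ℝ≥0∞ := fun z => ENNReal.ofReal ((1 + ‖z‖) ^ (-s))
  have hD : Measurable D := by fun_prop
  have hDint : ∫⁻ z, D z ∂μ < ∞ := finite_integral_one_add_norm hs
  set v := μ (Metric.closedBall (0 : E) r)
  have hv0 : v ≠ 0 := (Metric.measure_closedBall_pos μ 0 hr).ne'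
  have hv : v ≠ ∞ := measure_closedBall_lt_top.ne
  have hslow : ∀ z, ∀ w ∈ Metric.closedBall z r, D z ≤ ENNReal.ofReal ((1 + r) ^ s) * D w := by
    intro z w hw
    have hnorm : 1 + ‖w‖ ≤ (1 + r) * (1 + ‖z‖) := by
      nlinarith [norm_le_norm_add_norm_sub' w z, mem_closedBall_iff_norm.mp hw, norm_nonneg z]
    rw [← ENNReal.ofReal_mul (by positivity)]
    refine ENNReal.ofReal_le_ofReal ?_
    calc (1 + ‖z‖) ^ (-s) = (1 + r) ^ s * ((1 + r) * (1 + ‖z‖)) ^ (-s) := by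
          rw [Real.mul_rpow (by positivity) (by positivity), ← mul_assoc,
            ← Real.rpow_add (by positivity), add_neg_cancel, Real.rpow_zero, one_mul]
      _ ≤ (1 + r) ^ s * (1 + ‖w‖) ^ (-s) := by
          gcongr (1 + r) ^ s * ?_
          exact Real.rpow_le_rpow_of_nonpos (by positivity) hnorm (by linarith)
  refine ⟨v⁻¹ * (ENNReal.ofReal ((1 + r) ^ s) * ∫⁻ z, D z ∂μ), by finiteness, ?_⟩
  intro W K hW hK x
  rw [mul_assoc, ← ENNReal.mul_le_iff_le_inv hv0 hv]
  exact measure_closedBall_mul_lintegral_mul_le hW hD hslow hK x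

end Averaging

section KatoKernel

variable {V : R3 → ℝ}

lemma exists_lintegral_compl_closedBall_resolventKernel_le (hV : AEMeasurable V) {r : ℝ}
    (hr : 0 < r) {K : ℝ≥0∞} (hK : ∀ x, ∫⁻ y in Metric.closedBall x r, ‖V y‖ₑ ≤ K) :
    ∃ C : ℝ≥0∞, C ≠ ∞ ∧ ∀ l : ℝ, 0 < l → ∀ x,
      ∫⁻ y in (Metric.closedBall x r)ᶜ, ‖V y‖ₑ * resolventKernel l (x - y) ≤
        ENNReal.ofReal ((1 / l) ^ (3 / 2 : ℝ)) * (C * K) := by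
  obtain ⟨C, hC, hdecay⟩ :=
    exists_lintegral_mul_one_add_norm_rpow_le (E := R3) (μ := volume) (s := 4) (by norm_num) hr
  set c : ℝ := 32 * (1 + 1 / r) ^ 4 * Real.Gamma (3 / 2)
  have htail : ∀ l : ℝ, 0 < l → ∀ z : R3, r < ‖z‖ → resolventKernel l z ≤
      ENNReal.ofReal (c * (1 / l) ^ (3 / 2 : ℝ)) * ENNReal.ofReal ((1 + ‖z‖) ^ (-4 : ℝ)) := by
    intro l hl z hz
    have hz' : 0 < ‖z‖ := hr.trans hz
    have := Real.Gamma_pos_of_pos (s := 3 / 2) (by norm_num)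
    refine (resolventKernel_le_rpow hl (norm_pos_iff.mp hz')).trans ?_
    have hnorm : 1 + ‖z‖ ≤ (1 + 1 / r) * ‖z‖ := by
      have : 1 ≤ 1 / r * ‖z‖ := by rw [one_div_mul_eq_div, one_le_div hr]; exact hz.le
      linarith
    rw [← ENNReal.ofReal_mul (by positivity), Real.rpow_neg_ofNat, zpow_neg]
    refine ENNReal.ofReal_le_ofReal ?_
    calc 32 / ‖z‖ ^ 4 * ((1 / l) ^ (3 / 2 : ℝ) * Real.Gamma (3 / 2))
        = c * (1 / l) ^ (3 / 2 : ℝ) * (((1 + 1 / r) * ‖z‖) ^ 4)⁻¹ := by simp only [c]; field_simp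
      _ ≤ c * (1 / l) ^ (3 / 2 : ℝ) * ((1 + ‖z‖) ^ 4)⁻¹ := by gcongr
  refine ⟨ENNReal.ofReal c * C, by finiteness, fun l hl x => ?_⟩
  calc ∫⁻ y in (Metric.closedBall x r)ᶜ, ‖V y‖ₑ * resolventKernel l (x - y)
      ≤ ∫⁻ y in (Metric.closedBall x r)ᶜ, ENNReal.ofReal (c * (1 / l) ^ (3 / 2 : ℝ)) *
          (‖V y‖ₑ * ENNReal.ofReal ((1 + ‖x - y‖) ^ (-4 : ℝ))) := by
        refine setLIntegral_mono' measurableSet_closedBall.compl fun y hy => ?_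
        rw [mem_compl_iff, mem_closedBall_iff_norm', not_le] at hy
        rw [mul_left_comm]
        gcongr
        exact htail l hl _ hy
    _ ≤ ENNReal.ofReal (c * (1 / l) ^ (3 / 2 : ℝ)) * (C * K) := by
        rw [lintegral_const_mul' _ _ ENNReal.ofReal_ne_top]
        gcongr
        exact (setLIntegral_le_lintegral _ _).trans (hdecay _ K hV.enorm hK x)
    _ = ENNReal.ofReal ((1 / l) ^ (3 / 2 : ℝ)) * (ENNReal.ofReal c * C * K) := by
        rw [ENNReal.ofReal_mul' (by positivity)]
        ring

lemma lintegral_closedBall_resolventKernel_le {l : ℝ} (hl : 0 ≤ l) (r : ℝ) (x : R3) :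
    ∫⁻ y in Metric.closedBall x r, ‖V y‖ₑ * resolventKernel l (x - y) ≤
      ∫⁻ y in Metric.closedBall x r, ‖V y‖ₑ / ‖x - y‖ₑ := by
  gcongr with y
  rw [div_eq_mul_inv]
  gcongr
  exact resolventKernel_le_inv hl _

lemma lintegral_closedBall_enorm_le {r : ℝ} (hr : r ≤ 1) (x : R3) :
    ∫⁻ y in Metric.closedBall x r, ‖V y‖ₑ ≤
      ∫⁻ y in Metric.closedBall x r, ‖V y‖ₑ / ‖x - y‖ₑ := by
  refine setLIntegral_mono' measurableSet_closedBall fun y hy => ?_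
  rw [mem_closedBall_iff_norm'] at hy
  have h1 : ‖x - y‖ₑ ≤ 1 := by
    rw [← ofReal_norm, ENNReal.ofReal_le_one]
    exact hy.trans hr
  simpa using ENNReal.div_le_div_left h1 ‖V y‖ₑ

theorem KatoClass.eventually_lintegral_resolventKernel_le (hV : KatoClass V) {ε : ℝ≥0∞}
    (hε : 0 < ε) :
    ∀ᶠ l : ℝ in atTop, ∀ x, ∫⁻ y, ‖V y‖ₑ * resolventKernel l (x - y) ≤ ε := by
  obtain ⟨δ, hδ0, hδ⟩ := ENNReal.lt_iff_exists_nnreal_btwn.mp (ENNReal.half_pos hε.ne')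
  obtain ⟨r, hr, hr0, hr1⟩ :=
    ((hV.2.eventually_lt_const hδ0).and (Ioc_mem_nhdsGT (zero_lt_one' ℝ))).exists
  have hball : ∀ x : R3, ∫⁻ y in Metric.closedBall x r, ‖V y‖ₑ / ‖x - y‖ₑ ≤ δ := fun x =>
    (le_iSup (fun x : R3 => ∫⁻ y in Metric.closedBall x r, ‖V y‖ₑ / ‖x - y‖ₑ) x).trans hr.le
  obtain ⟨C, hC, hfar⟩ := exists_lintegral_compl_closedBall_resolventKernel_le hV.1 hr0
    fun x => (lintegral_closedBall_enorm_le hr1 x).trans (hball x)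
  have hlim : Tendsto (fun l : ℝ => ENNReal.ofReal ((1 / l) ^ (3 / 2 : ℝ)) * (C * δ)) atTop
      (𝓝 0) := by
    have hpow : Tendsto (fun l : ℝ => (1 / l) ^ (3 / 2 : ℝ)) atTop (𝓝 0) := by
      simpa using (tendsto_inv_atTop_zero (𝕜 := ℝ)).rpow_const (p := 3 / 2) (by right; norm_num)
    simpa using ENNReal.Tendsto.mul_const (b := C * δ) (ENNReal.tendsto_ofReal hpow)
      (.inr (by finiteness))
  filter_upwards [eventually_gt_atTop 0,
    hlim.eventually_lt_const (ENNReal.half_pos hε.ne')] with l hl hsmall x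
  calc ∫⁻ y, ‖V y‖ₑ * resolventKernel l (x - y)
      = (∫⁻ y in Metric.closedBall x r, ‖V y‖ₑ * resolventKernel l (x - y)) +
        ∫⁻ y in (Metric.closedBall x r)ᶜ, ‖V y‖ₑ * resolventKernel l (x - y) :=
        (lintegral_add_compl _ measurableSet_closedBall).symm
    _ ≤ ε / 2 + ε / 2 := by
        gcongr
        · exact (lintegral_closedBall_resolventKernel_le hl.le r x).trans
            ((hball x).trans hδ.le)
        · exact (hfar l hl x).trans hsmall.le
    _ = ε := ENNReal.add_halves ε

end KatoKernel

lemma enorm_complex_ofReal (r : ℝ) : ‖(r : ℂ)‖ₑ = ‖r‖ₑ := by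
  rw [← ofReal_norm, Complex.norm_real, ofReal_norm]

lemma enorm_integral_eq_lintegral_enorm {α : Type*} [MeasurableSpace α] {μ : Measure α}
    {f : α → ℂ} (hf : Integrable f μ) (hf0 : ∀ᵐ x ∂μ, (‖f x‖ : ℂ) = f x) :
    ‖∫ x, f x ∂μ‖ₑ = ∫⁻ x, ‖f x‖ₑ ∂μ := by
  rw [← integral_congr_ae hf0, integral_complex_ofReal, enorm_complex_ofReal,
    Real.enorm_of_nonneg (integral_nonneg fun _ => norm_nonneg _),
    ofReal_integral_norm_eq_lintegral_enorm hf]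

section FourierIntegral

variable {E : Type*} [NormedAddCommGroup E] [InnerProductSpace ℝ E] [FiniteDimensional ℝ E]
  [MeasurableSpace E] [BorelSpace E]

lemma continuous_fourier_of_integrable {f : E → ℂ} (hf : Integrable f) : Continuous (𝓕 f) :=
  VectorFourier.fourierIntegral_continuous Real.continuous_fourierChar
    (by simpa using continuous_inner) hf

lemma norm_fourier_le (f : E → ℂ) (ξ : E) : ‖𝓕 f ξ‖ ≤ ∫ x, ‖f x‖ :=
  VectorFourier.norm_fourierIntegral_le_integral_norm _ _ _ _ _

lemma integral_fourier_mul_eq_of_integrable {f g : E → ℂ} (hf : Integrable f)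
    (hg : Integrable g) : ∫ ξ, 𝓕 f ξ * g ξ = ∫ x, f x * 𝓕 g x := by
  have := VectorFourier.integral_fourierIntegral_smul_eq_flip (μ := volume) (ν := volume)
    (L := innerₗ E) (e := Real.fourierChar) (f := f) (g := g) Real.continuous_fourierChar
    (by simpa using continuous_inner) hf hg
  simpa [flip_innerₗ] using! this

lemma locallyIntegrable_coe (u : Lp ℂ 2 (volume : Measure E)) : LocallyIntegrable u :=
  (Lp.memLp u).locallyIntegrable (by norm_num)

lemma ae_eq_of_forall_integral_schwartz_eq {f g : E → ℂ} (hf : LocallyIntegrable f)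
    (hg : LocallyIntegrable g) (h : ∀ φ : 𝓢(E, ℂ), ∫ x, φ x * f x = ∫ x, φ x * g x) :
    f =ᵐ[volume] g := by
  refine ae_eq_of_integral_contDiff_smul_eq hf hg fun χ hχ hχ_supp => ?_
  have hsupp : HasCompactSupport (Complex.ofRealCLM ∘ χ) := hχ_supp.comp_left rfl
  have hsmooth : ContDiff ℝ ((⊤ : ℕ∞) : WithTop ℕ∞) (Complex.ofRealCLM ∘ χ) := by fun_prop
  simpa using h (hsupp.toSchwartzMap hsmooth)

lemma coe_fourier_toLp {f : E → ℂ} (hf : Integrable f) (hf2 : MemLp f 2) :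
    (𝓕 (hf2.toLp f) : Lp ℂ 2 volume) =ᵐ[volume] 𝓕 f := by
  refine ae_eq_of_forall_integral_schwartz_eq (locallyIntegrable_coe _)
    (continuous_fourier_of_integrable hf).locallyIntegrable fun φ => ?_
  have happly : ∀ (u : Lp ℂ 2 (volume : Measure E)) (ψ : 𝓢(E, ℂ)),
      Lp.toTemperedDistribution u ψ = ∫ x, ψ x * u x := fun u ψ => by
    simp [Lp.toTemperedDistribution_apply]
  calc ∫ x, φ x * (𝓕 (hf2.toLp f) : Lp ℂ 2 volume) x
      = Lp.toTemperedDistribution (hf2.toLp f) (𝓕 φ) := by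
        rw [← happly, ← Lp.fourier_toTemperedDistribution_eq, TemperedDistribution.fourier_apply]
    _ = ∫ x, 𝓕 φ x * f x := by
        rw [happly]
        exact integral_congr_ae (hf2.coeFn_toLp.mono fun x hx => by simp only [hx])
    _ = ∫ x, φ x * 𝓕 f x := by
        rw [SchwartzMap.fourier_coe, integral_fourier_mul_eq_of_integrable φ.integrable hf]

end FourierIntegral

section HeatSymbol

variable {E : Type*} [NormedAddCommGroup E]

/-- The Fourier symbol `exp(-4π²t|ξ|²)` of `e^{tΔ}`. -/
def heatSymbol (t : ℝ) (ξ : E) : ℝ := Real.exp (-(4 * π ^ 2 * t) * ‖ξ‖ ^ 2)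

/-- The Fourier symbol `4π²|ξ|² + l` of `-Δ + l`. -/
def laplacianSymbol (l : ℝ) (ξ : E) : ℝ≥0∞ := ENNReal.ofReal (4 * π ^ 2 * ‖ξ‖ ^ 2 + l)

lemma heatSymbol_pos (t : ℝ) (ξ : E) : 0 < heatSymbol t ξ := Real.exp_pos _

@[fun_prop]
lemma continuous_heatSymbol (t : ℝ) : Continuous (heatSymbol t : E → ℝ) := by
  unfold heatSymbol; fun_prop

lemma laplacianSymbol_ne_top (l : ℝ) (ξ : E) : laplacianSymbol l ξ ≠ ∞ := ENNReal.ofReal_ne_top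

lemma laplacianSymbol_pos {l : ℝ} (hl : 0 < l) (ξ : E) : 0 < laplacianSymbol l ξ :=
  ENNReal.ofReal_pos.mpr (by positivity)

lemma inv_laplacianSymbol {l : ℝ} (hl : 0 < l) (ξ : E) :
    (laplacianSymbol l ξ)⁻¹ =
      ∫⁻ t in Ioi (0 : ℝ),
        ENNReal.ofReal (Real.exp (-l * t)) * ENNReal.ofReal (heatSymbol t ξ) := by
  have hpos : 0 < 4 * π ^ 2 * ‖ξ‖ ^ 2 + l := by positivity
  calc (laplacianSymbol l ξ)⁻¹
      = ENNReal.ofReal (∫ t in Ioi (0 : ℝ), Real.exp (-(4 * π ^ 2 * ‖ξ‖ ^ 2 + l) * t)) := by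
        rw [laplacianSymbol, ← ENNReal.ofReal_inv_of_pos hpos, integral_exp_mul_Ioi (by linarith)]
        rw [mul_zero, Real.exp_zero, neg_div_neg_eq, one_div]
    _ = ∫⁻ t in Ioi (0 : ℝ), ENNReal.ofReal (Real.exp (-(4 * π ^ 2 * ‖ξ‖ ^ 2 + l) * t)) :=
        ofReal_integral_eq_lintegral_ofReal (integrableOn_exp_mul_Ioi (by linarith) 0)
          (ae_of_all _ fun t => (Real.exp_pos _).le)
    _ = _ := by
        refine lintegral_congr fun t => ?_
        rw [← ENNReal.ofReal_mul (Real.exp_pos _).le, heatSymbol, ← Real.exp_add]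
        ring_nf

variable [InnerProductSpace ℝ E] [FiniteDimensional ℝ E] [MeasurableSpace E] [BorelSpace E]

lemma integrable_heatSymbol {t : ℝ} (ht : 0 < t) : Integrable (heatSymbol t : E → ℝ) := by
  have hb : 0 < ((4 * π ^ 2 * t : ℝ) : ℂ).re := by rw [Complex.ofReal_re]; positivity
  refine (GaussianFourier.integrable_cexp_neg_mul_sq_norm_add (V := E) hb 0 0).norm.congr
    (ae_of_all _ fun ξ => ?_)
  simp only [Complex.norm_exp, heatSymbol]
  norm_cast
  simp

lemma fourier_heatSymbol_mul_exp_inner {t : ℝ} (ht : 0 < t) (x y : E) :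
    𝓕 (fun ξ : E => (heatSymbol t ξ : ℂ) * Complex.exp (2 * π * Complex.I * (inner ℝ x ξ : ℝ))) y =
      heatKernel t (x - y) := by
  have hgaussian := fourier_gaussian_innerProductSpace' (V := E) (b := (4 * π ^ 2 * t : ℝ))
    (by rw [Complex.ofReal_re]; positivity) x y
  have hbase : ((π : ℂ) / (4 * π ^ 2 * t : ℝ)) = ((4 * π * t)⁻¹ : ℝ) := by
    rw [← Complex.ofReal_div]; congr 1; field_simp
  have hexponent : -(π : ℂ) ^ 2 * (‖x - y‖ : ℂ) ^ 2 / (4 * π ^ 2 * t : ℝ) =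
      ((-‖x - y‖ ^ 2 / (4 * t) : ℝ) : ℂ) := by
    norm_cast; field_simp
  have hdim : (Module.finrank ℝ E : ℂ) / 2 = ((Module.finrank ℝ E / 2 : ℝ) : ℂ) := by push_cast; rfl
  rw [hbase, hexponent, hdim, ← Complex.ofReal_cpow (by positivity), ← Complex.ofReal_exp,
    ← Complex.ofReal_mul, Real.inv_rpow (by positivity), ← Real.rpow_neg (by positivity),
    ← neg_div] at hgaussian
  rw [heatKernel, ← hgaussian]
  refine congrArg (fun F : E → ℂ => 𝓕 F y) (funext fun ξ => ?_)
  rw [heatSymbol, Complex.exp_add]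
  push_cast
  rfl

lemma conj_fourier_heatSymbol_mul_conj_fourier {f : E → ℂ} (hf : Integrable f) {t : ℝ}
    (ht : 0 < t) (x : E) :
    conj (𝓕 (fun ξ : E => (heatSymbol t ξ : ℂ) * conj (𝓕 f ξ)) x) =
      ∫ y, f y * (heatKernel t (x - y) : ℂ) := by
  have hmode : Integrable fun ξ : E =>
      (heatSymbol t ξ : ℂ) * Complex.exp (2 * π * Complex.I * (inner ℝ x ξ : ℝ)) := by
    refine (integrable_heatSymbol ht).mono' (by fun_prop) (ae_of_all _ fun ξ => ?_)
    rw [norm_mul, Complex.norm_real, Real.norm_of_nonneg (heatSymbol_pos t ξ).le,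
      show 2 * (π : ℂ) * Complex.I * (inner ℝ x ξ : ℝ) =
        ((2 * π * inner ℝ x ξ : ℝ) : ℂ) * Complex.I by push_cast; ring,
      Complex.norm_exp_ofReal_mul_I, mul_one]
  calc conj (𝓕 (fun ξ : E => (heatSymbol t ξ : ℂ) * conj (𝓕 f ξ)) x)
      = ∫ ξ, 𝓕 f ξ *
          ((heatSymbol t ξ : ℂ) * Complex.exp (2 * π * Complex.I * (inner ℝ x ξ : ℝ))) := by
        rw [Real.fourier_eq', ← integral_conj]
        refine integral_congr_ae (ae_of_all _ fun ξ => ?_)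
        simp only
        rw [smul_eq_mul, map_mul, map_mul, Complex.conj_conj, ← Complex.exp_conj, map_mul,
          Complex.conj_I, Complex.conj_ofReal, Complex.conj_ofReal, real_inner_comm,
          show ((-2 * π * inner ℝ x ξ : ℝ) : ℂ) * -Complex.I =
            2 * π * Complex.I * (inner ℝ x ξ : ℝ) by push_cast; ring]
        ring
    _ = ∫ y, f y * (heatKernel t (x - y) : ℂ) := by
        rw [integral_fourier_mul_eq_of_integrable hf hmode]
        simp_rw [fourier_heatSymbol_mul_exp_inner ht]

lemma integrable_heatSymbol_mul_conj_fourier {f : E → ℂ} (hf : Integrable f) {t : ℝ}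
    (ht : 0 < t) : Integrable fun ξ : E => (heatSymbol t ξ : ℂ) * conj (𝓕 f ξ) := by
  have hcont := continuous_fourier_of_integrable hf
  refine ((integrable_heatSymbol ht).mul_const (∫ x, ‖f x‖)).mono'
    (by fun_prop : Continuous _).aestronglyMeasurable (ae_of_all _ fun ξ => ?_)
  rw [norm_mul, Complex.norm_real, Real.norm_of_nonneg (heatSymbol_pos t ξ).le, RCLike.norm_conj]
  gcongr
  · exact (heatSymbol_pos t ξ).le
  · exact norm_fourier_le f ξ

lemma lintegral_heatSymbol_mul_fourier_sq_eq {f : E → ℂ} (hf : Integrable f) {t : ℝ}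
    (ht : 0 < t) :
    ∫⁻ ξ, ENNReal.ofReal (heatSymbol t ξ) * ‖𝓕 f ξ‖ₑ ^ 2 =
      ‖∫ ξ, 𝓕 f ξ * ((heatSymbol t ξ : ℂ) * conj (𝓕 f ξ))‖ₑ := by
  have hint : Integrable fun ξ : E => 𝓕 f ξ * ((heatSymbol t ξ : ℂ) * conj (𝓕 f ξ)) :=
    (integrable_heatSymbol_mul_conj_fourier hf ht).bdd_mul
      (continuous_fourier_of_integrable hf).aestronglyMeasurable (ae_of_all _ (norm_fourier_le f))
  rw [enorm_integral_eq_lintegral_enorm hint]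
  · refine lintegral_congr fun ξ => ?_
    rw [enorm_mul, enorm_mul, RCLike.enorm_conj, enorm_complex_ofReal,
      Real.enorm_of_nonneg (heatSymbol_pos t ξ).le]
    ring
  · refine ae_of_all _ fun ξ => ?_
    rw [mul_left_comm, Complex.mul_conj']
    norm_cast
    rw [Real.norm_of_nonneg (mul_nonneg (heatSymbol_pos t ξ).le (by positivity))]

lemma lintegral_heatSymbol_mul_fourier_sq_le {f : E → ℂ} (hf : Integrable f) {t : ℝ}
    (ht : 0 < t) :
    ∫⁻ ξ, ENNReal.ofReal (heatSymbol t ξ) * ‖𝓕 f ξ‖ₑ ^ 2 ≤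
      ∫⁻ p, ‖f p.1‖ₑ * ‖f p.2‖ₑ * ENNReal.ofReal (heatKernel t (p.1 - p.2))
        ∂((volume : Measure E).prod volume) := by
  set g : E → ℂ := fun ξ => (heatSymbol t ξ : ℂ) * conj (𝓕 f ξ)
  have hg : Integrable g := integrable_heatSymbol_mul_conj_fourier hf ht
  have hpointwise : ∀ x, ‖𝓕 g x‖ₑ ≤ ∫⁻ y, ‖f y‖ₑ * ENNReal.ofReal (heatKernel t (x - y)) := by
    intro x
    rw [← RCLike.enorm_conj, conj_fourier_heatSymbol_mul_conj_fourier hf ht]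
    refine (enorm_integral_le_lintegral_enorm _).trans_eq (lintegral_congr fun y => ?_)
    rw [enorm_mul, enorm_complex_ofReal, Real.enorm_of_nonneg (heatKernel_nonneg ht _)]
  have hfe := hf.aestronglyMeasurable.enorm
  calc ∫⁻ ξ, ENNReal.ofReal (heatSymbol t ξ) * ‖𝓕 f ξ‖ₑ ^ 2
      = ‖∫ x, f x * 𝓕 g x‖ₑ := by
        rw [lintegral_heatSymbol_mul_fourier_sq_eq hf ht,
          integral_fourier_mul_eq_of_integrable hf hg]
    _ ≤ ∫⁻ x, ‖f x‖ₑ * ∫⁻ y, ‖f y‖ₑ * ENNReal.ofReal (heatKernel t (x - y)) := by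
        refine (enorm_integral_le_lintegral_enorm _).trans (lintegral_mono fun x => ?_)
        rw [enorm_mul]
        gcongr
        exact hpointwise x
    _ = _ := by
        have hheat : Measurable fun p : E × E => heatKernel t (p.1 - p.2) := by
          unfold heatKernel; fun_prop
        rw [lintegral_prod (fun p : E × E => ‖f p.1‖ₑ * ‖f p.2‖ₑ * _)
          ((hfe.comp_fst.mul hfe.comp_snd).mul hheat.ennreal_ofReal.aemeasurable)]
        refine lintegral_congr fun x => ?_
        rw [← lintegral_const_mul' _ _ enorm_ne_top]
        exact lintegral_congr fun y => (mul_assoc _ _ _).symm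

lemma lintegral_fourier_sq_div_laplacianSymbol_le {f : E → ℂ} (hf : Integrable f) {l : ℝ}
    (hl : 0 < l) :
    ∫⁻ ξ, ‖𝓕 f ξ‖ₑ ^ 2 * (laplacianSymbol l ξ)⁻¹ ≤
      ∫⁻ p, ‖f p.1‖ₑ * ‖f p.2‖ₑ * resolventKernel l (p.1 - p.2)
        ∂((volume : Measure E).prod volume) := by
  have hfe := hf.aestronglyMeasurable.enorm
  have hff : AEMeasurable (fun p : E × E => ‖f p.1‖ₑ * ‖f p.2‖ₑ) (volume.prod volume) :=
    hfe.comp_fst.mul hfe.comp_snd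
  have hcont := (continuous_fourier_of_integrable hf).measurable
  calc ∫⁻ ξ, ‖𝓕 f ξ‖ₑ ^ 2 * (laplacianSymbol l ξ)⁻¹
      = ∫⁻ ξ, ∫⁻ t in Ioi (0 : ℝ), ENNReal.ofReal (Real.exp (-l * t)) *
          (ENNReal.ofReal (heatSymbol t ξ) * ‖𝓕 f ξ‖ₑ ^ 2) := by
        refine lintegral_congr fun ξ => ?_
        rw [inv_laplacianSymbol hl, ← lintegral_const_mul' _ _ (by finiteness)]
        exact lintegral_congr fun t => by ring
    _ = ∫⁻ t in Ioi (0 : ℝ), ENNReal.ofReal (Real.exp (-l * t)) *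
          ∫⁻ ξ, ENNReal.ofReal (heatSymbol t ξ) * ‖𝓕 f ξ‖ₑ ^ 2 := by
        rw [lintegral_lintegral_swap]
        · exact lintegral_congr fun t => lintegral_const_mul' _ _ ENNReal.ofReal_ne_top
        · unfold heatSymbol Function.uncurry
          have : Measurable fun p : E × ℝ => ‖𝓕 f p.1‖ₑ := (hcont.comp measurable_fst).enorm
          fun_prop
    _ ≤ ∫⁻ t in Ioi (0 : ℝ), ENNReal.ofReal (Real.exp (-l * t)) *
          ∫⁻ p, ‖f p.1‖ₑ * ‖f p.2‖ₑ * ENNReal.ofReal (heatKernel t (p.1 - p.2))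
            ∂(volume.prod volume) := by
        refine setLIntegral_mono' measurableSet_Ioi fun t ht => ?_
        gcongr
        exact lintegral_heatSymbol_mul_fourier_sq_le hf ht
    _ = ∫⁻ p, (∫⁻ t in Ioi (0 : ℝ), ‖f p.1‖ₑ * ‖f p.2‖ₑ *
          ENNReal.ofReal (Real.exp (-l * t) * heatKernel t (p.1 - p.2))) ∂(volume.prod volume) := by
        have hkernel : Measurable fun q : (E × E) × ℝ =>
            ENNReal.ofReal (Real.exp (-l * q.2) * heatKernel q.2 (q.1.1 - q.1.2)) := by
          unfold heatKernel; fun_prop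
        rw [lintegral_lintegral_swap (hff.comp_fst.mul hkernel.aemeasurable)]
        refine lintegral_congr fun t => ?_
        rw [← lintegral_const_mul' _ _ ENNReal.ofReal_ne_top]
        refine lintegral_congr fun p => ?_
        rw [ENNReal.ofReal_mul (Real.exp_pos _).le]
        ring
    _ = _ := lintegral_congr fun p => lintegral_const_mul' _ _ (by finiteness)

end HeatSymbol

section SchurTest

variable {α : Type*} [MeasurableSpace α] {μ : Measure α}

lemma sq_lintegral_mul_le {f g : α → ℝ≥0∞} (hf : AEMeasurable f μ) (hg : AEMeasurable g μ) :
    (∫⁻ x, f x * g x ∂μ) ^ 2 ≤ (∫⁻ x, f x ^ 2 ∂μ) * ∫⁻ x, g x ^ 2 ∂μ := by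
  have hholder := ENNReal.lintegral_mul_le_Lp_mul_Lq μ Real.HolderConjugate.two_two hf hg
  simp only [Pi.mul_apply, ENNReal.rpow_two] at hholder
  calc (∫⁻ x, f x * g x ∂μ) ^ 2
      ≤ ((∫⁻ x, f x ^ 2 ∂μ) ^ (1 / 2 : ℝ) * (∫⁻ x, g x ^ 2 ∂μ) ^ (1 / 2 : ℝ)) ^ 2 := by gcongr
    _ = (∫⁻ x, f x ^ 2 ∂μ) * ∫⁻ x, g x ^ 2 ∂μ := by
      rw [mul_pow, ← ENNReal.rpow_mul_natCast, ← ENNReal.rpow_mul_natCast]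
      norm_num

lemma lintegral_symm_kernel_mul_le [SFinite μ] {k : α → α → ℝ≥0∞}
    (hk : Measurable (Function.uncurry k)) (hsymm : ∀ x y, k x y = k y x) {p : α → ℝ≥0∞}
    (hp : ∀ x, ∫⁻ y, k x y ∂μ ≤ p x) {g : α → ℝ≥0∞} (hg : Measurable g) :
    ∫⁻ q, g q.1 * g q.2 * k q.1 q.2 ∂(μ.prod μ) ≤ ∫⁻ x, p x * g x ^ 2 ∂μ := by
  set I := ∫⁻ q, g q.1 ^ 2 * k q.1 q.2 ∂(μ.prod μ)
  have hswap : ∫⁻ q, g q.2 ^ 2 * k q.1 q.2 ∂(μ.prod μ) = I := by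
    rw [← lintegral_prod_swap]
    simp only [Prod.fst_swap, Prod.snd_swap, hsymm, I]
  have hkernel : Measurable fun q : α × α => k q.1 q.2 := hk
  calc ∫⁻ q, g q.1 * g q.2 * k q.1 q.2 ∂(μ.prod μ)
      ≤ ∫⁻ q, 2⁻¹ * (g q.1 ^ 2 * k q.1 q.2) + 2⁻¹ * (g q.2 ^ 2 * k q.1 q.2) ∂(μ.prod μ) := by
        refine lintegral_mono fun q => ?_
        have hyoung := ENNReal.young_inequality (g q.1) (g q.2) Real.HolderConjugate.two_two
        simp only [ENNReal.rpow_two, ENNReal.ofReal_ofNat, div_eq_mul_inv] at hyoung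
        calc g q.1 * g q.2 * k q.1 q.2 ≤ (g q.1 ^ 2 * 2⁻¹ + g q.2 ^ 2 * 2⁻¹) * k q.1 q.2 := by
              gcongr
          _ = 2⁻¹ * (g q.1 ^ 2 * k q.1 q.2) + 2⁻¹ * (g q.2 ^ 2 * k q.1 q.2) := by ring
    _ = 2⁻¹ * I + 2⁻¹ * I := by
        rw [lintegral_add_left (by fun_prop), lintegral_const_mul _ (by fun_prop),
          lintegral_const_mul _ (by fun_prop), hswap]
    _ = I := by rw [← add_mul, ENNReal.inv_two_add_inv_two, one_mul]
    _ = ∫⁻ x, (∫⁻ y, k x y ∂μ) * g x ^ 2 ∂μ := by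
        simp only [I]
        rw [lintegral_prod (fun q : α × α => g q.1 ^ 2 * k q.1 q.2) (by fun_prop)]
        refine lintegral_congr fun x => ?_
        simp only
        rw [lintegral_const_mul _ hk.of_uncurry_left, mul_comm]
    _ ≤ ∫⁻ x, p x * g x ^ 2 ∂μ := by
        gcongr with x
        exact hp x

end SchurTest

section LpTwo

variable {α : Type*} [MeasurableSpace α] {μ : Measure α}

lemma lintegral_enorm_sq (u : Lp ℂ 2 μ) : ∫⁻ x, ‖u x‖ₑ ^ 2 ∂μ = ‖u‖ₑ ^ 2 := by
  have h := eLpNorm_nnreal_pow_eq_lintegral (μ := μ) (f := u) (p := 2) (by norm_num)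
  simp only [NNReal.coe_ofNat, ENNReal.rpow_two, ENNReal.coe_ofNat] at h
  rw [Lp.enorm_def, h]

lemma inner_eq_integral (u v : Lp ℂ 2 μ) : inner ℂ u v = ∫ x, conj (u x) * v x ∂μ := by
  rw [L2.inner_def]
  simp only [RCLike.inner_apply, mul_comm]

end LpTwo

section FormBoundedness

variable {E : Type*} [NormedAddCommGroup E] [InnerProductSpace ℝ E] [FiniteDimensional ℝ E]
  [MeasurableSpace E] [BorelSpace E]

lemma lintegral_enorm_fourier_sq (u : Lp ℂ 2 (volume : Measure E)) :
    ∫⁻ ξ, ‖(𝓕 u : Lp ℂ 2 volume) ξ‖ₑ ^ 2 = ENNReal.ofReal (‖u‖ ^ 2) := by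
  rw [lintegral_enorm_sq, ← ofReal_norm, Lp.norm_fourier_eq, ENNReal.ofReal_pow (norm_nonneg _)]

lemma lintegral_fourier_mul_sq_le {w u : E → ℂ} (hw : Measurable w) (hu : Measurable u)
    (hwu : Integrable fun x => w x * u x) {l : ℝ} (hl : 0 < l) {M : ℝ≥0∞}
    (hM : ∀ x, ∫⁻ y, ‖w y‖ₑ * resolventKernel l (x - y) ≤ M) :
    ∫⁻ ξ, ‖𝓕 (fun x => w x * u x) ξ‖ₑ ^ 2 * (laplacianSymbol l ξ)⁻¹ ≤
      M * ∫⁻ x, ‖w x‖ₑ * ‖u x‖ₑ ^ 2 := by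
  set k : E → E → ℝ≥0∞ := fun x y => ‖w x‖ₑ * (‖w y‖ₑ * resolventKernel l (x - y))
  have hk : Measurable (Function.uncurry k) := by
    have hfst : Measurable fun p : E × E => ‖w p.1‖ₑ := (hw.comp measurable_fst).enorm
    have hsnd : Measurable fun p : E × E => ‖w p.2‖ₑ := (hw.comp measurable_snd).enorm
    exact hfst.mul (hsnd.mul (by fun_prop))
  have hsymm : ∀ x y, k x y = k y x := fun x y => by
    simp only [k]
    rw [← neg_sub x y, resolventKernel_neg, mul_left_comm]
  have hp : ∀ x, ∫⁻ y, k x y ≤ M * ‖w x‖ₑ := fun x => by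
    rw [lintegral_const_mul' _ _ enorm_ne_top, mul_comm]
    gcongr
    exact hM x
  calc ∫⁻ ξ, ‖𝓕 (fun x => w x * u x) ξ‖ₑ ^ 2 * (laplacianSymbol l ξ)⁻¹
      ≤ ∫⁻ q, ‖w q.1 * u q.1‖ₑ * ‖w q.2 * u q.2‖ₑ * resolventKernel l (q.1 - q.2)
          ∂(volume.prod volume) := lintegral_fourier_sq_div_laplacianSymbol_le hwu hl
    _ = ∫⁻ q, ‖u q.1‖ₑ * ‖u q.2‖ₑ * k q.1 q.2 ∂(volume.prod volume) := by
        refine lintegral_congr fun q => ?_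
        simp only [enorm_mul, k]
        ring
    _ ≤ ∫⁻ x, M * ‖w x‖ₑ * ‖u x‖ₑ ^ 2 := lintegral_symm_kernel_mul_le hk hsymm hp hu.enorm
    _ = M * ∫⁻ x, ‖w x‖ₑ * ‖u x‖ₑ ^ 2 := by
        simp_rw [mul_assoc]
        rw [lintegral_const_mul _ (by fun_prop)]

lemma sq_lintegral_mul_fourier_le {f h : E → ℂ} (hf : Measurable f) (hh : Measurable h) {l : ℝ}
    (hl : 0 < l) :
    (∫⁻ ξ, ‖f ξ‖ₑ * ‖h ξ‖ₑ) ^ 2 ≤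
      (∫⁻ ξ, laplacianSymbol l ξ * ‖f ξ‖ₑ ^ 2) * ∫⁻ ξ, ‖h ξ‖ₑ ^ 2 * (laplacianSymbol l ξ)⁻¹ := by
  set s : E → ℝ≥0∞ := fun ξ => laplacianSymbol l ξ ^ (1 / 2 : ℝ)
  have hs : Measurable s := by unfold s laplacianSymbol; fun_prop
  have hs_sq : ∀ ξ, s ξ ^ 2 = laplacianSymbol l ξ := fun ξ => by
    simp only [s]
    rw [← ENNReal.rpow_mul_natCast]
    norm_num
  have hs0 : ∀ ξ, s ξ ≠ 0 := fun ξ => by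
    rw [← pow_ne_zero_iff two_ne_zero, hs_sq]
    exact (laplacianSymbol_pos hl ξ).ne'
  have hs_top : ∀ ξ, s ξ ≠ ∞ := fun ξ =>
    ENNReal.rpow_ne_top_of_nonneg (by norm_num) (laplacianSymbol_ne_top l ξ)
  calc (∫⁻ ξ, ‖f ξ‖ₑ * ‖h ξ‖ₑ) ^ 2
      = (∫⁻ ξ, (s ξ * ‖f ξ‖ₑ) * ((s ξ)⁻¹ * ‖h ξ‖ₑ)) ^ 2 := by
        congr 1
        refine lintegral_congr fun ξ => ?_
        rw [mul_mul_mul_comm, ENNReal.mul_inv_cancel (hs0 ξ) (hs_top ξ), one_mul]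
    _ ≤ (∫⁻ ξ, (s ξ * ‖f ξ‖ₑ) ^ 2) * ∫⁻ ξ, ((s ξ)⁻¹ * ‖h ξ‖ₑ) ^ 2 :=
        sq_lintegral_mul_le (by fun_prop) (by fun_prop)
    _ = _ := by
        simp_rw [mul_pow, ← ENNReal.inv_pow, hs_sq, mul_comm (‖h _‖ₑ ^ 2)]

lemma lintegral_mul_enorm_sq_le_lintegral_fourier {w : E → ℝ} (hw0 : ∀ x, 0 ≤ w x)
    (u : Lp ℂ 2 (volume : Measure E)) (hwu : Integrable fun x => (w x : ℂ) * u x)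
    (hwu2 : MemLp (fun x => (w x : ℂ) * u x) 2) :
    ∫⁻ x, ‖w x‖ₑ * ‖u x‖ₑ ^ 2 ≤
      ∫⁻ ξ, ‖(𝓕 u : Lp ℂ 2 volume) ξ‖ₑ * ‖𝓕 (fun x => (w x : ℂ) * u x) ξ‖ₑ := by
  have hprod : Integrable fun x => conj (u x) * ((w x : ℂ) * u x) :=
    MemLp.integrable_mul (Lp.memLp u).star hwu2
  have hreal : ∀ x, conj (u x) * ((w x : ℂ) * u x) = ((w x * ‖u x‖ ^ 2 : ℝ) : ℂ) := fun x => by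
    rw [mul_left_comm, Complex.conj_mul']
    push_cast
    rfl
  calc ∫⁻ x, ‖w x‖ₑ * ‖u x‖ₑ ^ 2
      = ‖∫ x, conj (u x) * ((w x : ℂ) * u x)‖ₑ := by
        rw [enorm_integral_eq_lintegral_enorm hprod]
        · refine lintegral_congr fun x => ?_
          rw [enorm_mul, enorm_mul, RCLike.enorm_conj, enorm_complex_ofReal]
          ring
        · refine ae_of_all _ fun x => ?_
          rw [hreal, Complex.norm_of_nonneg (mul_nonneg (hw0 x) (by positivity))]
    _ = ‖inner ℂ (𝓕 u) (𝓕 (hwu2.toLp _))‖ₑ := by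
        rw [Lp.inner_fourier_eq, inner_eq_integral]
        congr 1
        refine integral_congr_ae ?_
        filter_upwards [hwu2.coeFn_toLp] with x hx
        rw [hx]
    _ ≤ ∫⁻ ξ, ‖(𝓕 u : Lp ℂ 2 volume) ξ‖ₑ * ‖𝓕 (fun x => (w x : ℂ) * u x) ξ‖ₑ := by
        rw [inner_eq_integral]
        refine (enorm_integral_le_lintegral_enorm _).trans_eq (lintegral_congr_ae ?_)
        filter_upwards [coe_fourier_toLp hwu hwu2] with ξ hξ
        rw [hξ, enorm_mul, RCLike.enorm_conj]

/-- The energy `‖∇u‖² + l‖u‖²`, computed on the Fourier side. -/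
def energy (l : ℝ) (u : Lp ℂ 2 (volume : Measure E)) : ℝ≥0∞ :=
  ∫⁻ ξ, laplacianSymbol l ξ * ‖(𝓕 u : Lp ℂ 2 volume) ξ‖ₑ ^ 2

-- With `A = ∫ w|u|²`, duality gives `A = ⟪u, wu⟫ ≤ ‖u‖_{H¹} ‖wu‖_{H⁻¹}`, where the `H⁻¹` norm is
-- in turn bounded by `(M A)^{1/2}`; the a priori finiteness of `A` allows one to cancel.
lemma lintegral_mul_enorm_sq_le_of_bounded {w : E → ℝ} (hw : Measurable w) (hw0 : ∀ x, 0 ≤ w x)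
    {c : ℝ} (hwc : ∀ x, w x ≤ c) (hw2 : MemLp w 2) {l : ℝ} (hl : 0 < l) {M : ℝ≥0∞}
    (hM : ∀ x, ∫⁻ y, ‖w y‖ₑ * resolventKernel l (x - y) ≤ M)
    (u : Lp ℂ 2 (volume : Measure E)) :
    ∫⁻ x, ‖w x‖ₑ * ‖u x‖ₑ ^ 2 ≤ M * energy l u := by
  set A := ∫⁻ x, ‖w x‖ₑ * ‖u x‖ₑ ^ 2
  have hu : Measurable u := (Lp.stronglyMeasurable u).measurable
  have hw_bound : ∀ x, ‖w x‖ ≤ c := fun x => by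
    rw [Real.norm_of_nonneg (hw0 x)]
    exact hwc x
  have hwtop : MemLp w ∞ := memLp_top_of_bound hw.aestronglyMeasurable c (ae_of_all _ hw_bound)
  have hwu : Integrable fun x => (w x : ℂ) * u x := MemLp.integrable_mul hw2.ofReal (Lp.memLp u)
  have hwu2 : MemLp (fun x => (w x : ℂ) * u x) 2 := MemLp.mul (Lp.memLp u) hwtop.ofReal
  have hA : A ≠ ∞ := by
    refine ne_top_of_le_ne_top (b := ENNReal.ofReal c * ‖u‖ₑ ^ 2) (by finiteness) ?_
    rw [← lintegral_enorm_sq, ← lintegral_const_mul' _ _ ENNReal.ofReal_ne_top]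
    refine lintegral_mono fun x => mul_le_mul_left ?_ _
    rw [← ofReal_norm]
    exact ENNReal.ofReal_le_ofReal (hw_bound x)
  have hsq : A * A ≤ A * (M * energy l u) := by
    calc A * A
        ≤ (∫⁻ ξ, ‖(𝓕 u : Lp ℂ 2 volume) ξ‖ₑ * ‖𝓕 (fun x => (w x : ℂ) * u x) ξ‖ₑ) ^ 2 := by
          rw [← sq]
          gcongr
          exact lintegral_mul_enorm_sq_le_lintegral_fourier hw0 u hwu hwu2
      _ ≤ energy l u *
            ∫⁻ ξ, ‖𝓕 (fun x => (w x : ℂ) * u x) ξ‖ₑ ^ 2 * (laplacianSymbol l ξ)⁻¹ :=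
          sq_lintegral_mul_fourier_le (Lp.stronglyMeasurable _).measurable
            (continuous_fourier_of_integrable hwu).measurable hl
      _ ≤ energy l u * (M * A) := by
          gcongr
          simpa only [enorm_complex_ofReal] using
            lintegral_fourier_mul_sq_le (w := fun x => (w x : ℂ)) (by fun_prop) hu hwu hl
              (by simpa only [enorm_complex_ofReal] using hM)
      _ = A * (M * energy l u) := by ring
  rcases eq_or_ne A 0 with h0 | h0
  · simp [h0]
  · exact (ENNReal.mul_le_mul_iff_right h0 hA).mp hsq

lemma setLIntegral_mul_enorm_sq_le_of_bounded {V : E → ℝ} (hV : Measurable V) {s : Set E}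
    (hs : MeasurableSet s) (hs_fin : volume s ≠ ∞) {C : ℝ} (hC : 0 ≤ C) (hVC : ∀ x ∈ s, ‖V x‖ ≤ C)
    {l : ℝ} (hl : 0 < l) {M : ℝ≥0∞} (hM : ∀ x, ∫⁻ y, ‖V y‖ₑ * resolventKernel l (x - y) ≤ M)
    (u : Lp ℂ 2 (volume : Measure E)) :
    ∫⁻ x in s, ‖V x‖ₑ * ‖u x‖ₑ ^ 2 ≤ M * energy l u := by
  set w : E → ℝ := s.indicator fun x => ‖V x‖
  have hw0 : ∀ x, 0 ≤ w x := indicator_nonneg fun _ _ => norm_nonneg _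
  have hwC : ∀ x, w x ≤ C := indicator_le' hVC fun _ _ => hC
  have hw : Measurable w := hV.norm.indicator hs
  have hwV : ∀ x, ‖w x‖ₑ = s.indicator (fun x => ‖V x‖ₑ) x := fun x => by
    simp only [w, enorm_indicator_eq_indicator_enorm, enorm_norm]
  have hw2 : MemLp w 2 := by
    rw [memLp_indicator_iff_restrict hs]
    have : IsFiniteMeasure (volume.restrict s) := isFiniteMeasure_restrict.mpr hs_fin
    refine MemLp.of_bound (by fun_prop) C ((ae_restrict_iff' hs).mpr ?_)
    exact ae_of_all _ fun x hx => by simpa using hVC x hx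
  calc ∫⁻ x in s, ‖V x‖ₑ * ‖u x‖ₑ ^ 2 = ∫⁻ x, ‖w x‖ₑ * ‖u x‖ₑ ^ 2 := by
        rw [← lintegral_indicator hs]
        refine lintegral_congr fun x => ?_
        rw [hwV, indicator_mul_left]
    _ ≤ M * energy l u := by
        refine lintegral_mul_enorm_sq_le_of_bounded hw hw0 hwC hw2 hl (fun x => ?_) u
        refine (lintegral_mono fun y => ?_).trans (hM x)
        rw [hwV]
        gcongr
        exact indicator_le_self _ _ _

lemma lintegral_mul_enorm_sq_le_of_measurable {V : E → ℝ} (hV : Measurable V) {l : ℝ}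
    (hl : 0 < l) {M : ℝ≥0∞} (hM : ∀ x, ∫⁻ y, ‖V y‖ₑ * resolventKernel l (x - y) ≤ M)
    (u : Lp ℂ 2 (volume : Measure E)) :
    ∫⁻ x, ‖V x‖ₑ * ‖u x‖ₑ ^ 2 ≤ M * energy l u := by
  set S : ℕ → Set E := fun n => Metric.closedBall 0 n ∩ {x | ‖V x‖ ≤ n}
  have hS : ∀ n, MeasurableSet (S n) := fun n =>
    measurableSet_closedBall.inter (measurableSet_le hV.norm measurable_const)
  have hSmono : Monotone S := fun m n hmn => by
    have hmn' : (m : ℝ) ≤ n := by exact_mod_cast hmn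
    exact inter_subset_inter (Metric.closedBall_subset_closedBall hmn') fun x hx => hx.trans hmn'
  have hSunion : ⋃ n, S n = univ := by
    refine eq_univ_of_forall fun x => mem_iUnion.mpr ⟨⌈max ‖x‖ ‖V x‖⌉₊, ?_⟩
    have hle := Nat.le_ceil (max ‖x‖ ‖V x‖)
    exact ⟨by simpa using (le_max_left _ _).trans hle, (le_max_right _ _).trans hle⟩
  have hSfin : ∀ n, volume (S n) ≠ ∞ := fun n =>
    measure_ne_top_of_subset inter_subset_left measure_closedBall_lt_top.ne
  rw [← setLIntegral_univ, ← hSunion, setLIntegral_iUnion_of_directed _ hSmono.directed_le]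
  exact iSup_le fun n => setLIntegral_mul_enorm_sq_le_of_bounded hV (hS n) (hSfin n)
    n.cast_nonneg (fun x hx => hx.2) hl hM u

lemma lintegral_mul_enorm_sq_le {V : E → ℝ} (hV : AEMeasurable V) {l : ℝ} (hl : 0 < l)
    {M : ℝ≥0∞} (hM : ∀ x, ∫⁻ y, ‖V y‖ₑ * resolventKernel l (x - y) ≤ M)
    (u : Lp ℂ 2 (volume : Measure E)) :
    ∫⁻ x, ‖V x‖ₑ * ‖u x‖ₑ ^ 2 ≤ M * energy l u := by
  have hcongr : ∀ f : E → ℝ≥0∞, ∫⁻ x, ‖hV.mk V x‖ₑ * f x = ∫⁻ x, ‖V x‖ₑ * f x := fun f =>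
    lintegral_congr_ae (hV.ae_eq_mk.mono fun x hx => by simp only [hx])
  rw [← hcongr]
  refine lintegral_mul_enorm_sq_le_of_measurable hV.measurable_mk hl (fun x => ?_) u
  rw [hcongr]
  exact hM x

end FormBoundedness

section Distributions

lemma toDist_apply (u : L2) (φ : 𝓢(R3, ℂ)) : toDist u φ = ∫ x, φ x * u x := by
  simp [toDist, Lp.toTemperedDistribution_apply]

lemma toDist_injective : Function.Injective toDist :=
  LinearMap.ker_eq_bot.mp
    (Lp.ker_toTemperedDistributionCLM_eq_bot (E := R3) (F := ℂ) (μ := volume) (p := 2))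

lemma toDist_add (u v : L2) : toDist (u + v) = toDist u + toDist v :=
  map_add (Lp.toTemperedDistributionCLM ℂ volume 2) u v

lemma toDist_sub (u v : L2) : toDist (u - v) = toDist u - toDist v :=
  map_sub (Lp.toTemperedDistributionCLM ℂ volume 2) u v

lemma toDist_smul (c : ℂ) (u : L2) : toDist (c • u) = c • toDist u :=
  map_smul (Lp.toTemperedDistributionCLM ℂ volume 2) c u

lemma fourier_toDist (u : L2) : 𝓕 (toDist u) = toDist (𝓕 u) :=
  Lp.fourier_toTemperedDistribution_eq u

lemma IsRegular.eq {w : R3 → ℂ} {T T' : 𝓢'(R3, ℂ)} (h : IsRegular w T) (h' : IsRegular w T') :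
    T = T' := by
  ext φ
  rw [(h φ).2, (h' φ).2]

lemma IsRegular.isRegular_regular {w : R3 → ℂ} {T : 𝓢'(R3, ℂ)} (h : IsRegular w T) :
    IsRegular w (regular w) := by
  have hex : ∃ T, IsRegular w T := ⟨T, h⟩
  rw [regular, dif_pos hex]
  exact hex.choose_spec

lemma IsRegular.regular_eq {w : R3 → ℂ} {T : 𝓢'(R3, ℂ)} (h : IsRegular w T) : regular w = T :=
  h.isRegular_regular.eq h

end Distributions

section Energy

variable {u : L2} {g : Fin 3 → L2}

lemma exists_hasGradient (hu : u ∈ H1) : ∃ g, HasGradient u g := by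
  have hpartial : ∀ i : Fin 3, ∃ g : L2,
      ∂_{EuclideanSpace.single i (1 : ℝ)} (toDist u) = toDist g := fun i => by
    have h := TemperedDistribution.MemSobolev.lineDerivOp (m := EuclideanSpace.single i (1 : ℝ)) hu
    rwa [sub_self, TemperedDistribution.memSobolev_zero_iff] at h
  choose g hg using hpartial
  exact ⟨g, hg⟩

lemma HasGradient.coe_fourier (h : HasGradient u g) (i : Fin 3) :
    (𝓕 (g i) : L2) =ᵐ[volume] fun ξ => 2 * π * Complex.I * ξ i * (𝓕 u : L2) ξ := by
  set e : R3 := EuclideanSpace.single i 1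
  have htg : (fun x : R3 => ((inner ℝ x e : ℝ) : ℂ)).HasTemperateGrowth := by fun_prop
  have hcoord : ∀ x : R3, inner ℝ x e = x i := by
    simp [e, EuclideanSpace.inner_single_right]
  have hsymbol : Continuous fun ξ : R3 => 2 * (π : ℂ) * Complex.I * ξ i := by fun_prop
  refine ae_eq_of_forall_integral_schwartz_eq (locallyIntegrable_coe _)
    ((locallyIntegrable_coe (𝓕 u)).continuous_mul hsymbol) fun φ => ?_
  calc ∫ ξ, φ ξ * (𝓕 (g i) : L2) ξ
      = (𝓕 (∂_{e} (toDist u)) : 𝓢'(R3, ℂ)) φ := by rw [h i, fourier_toDist, toDist_apply]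
    _ = 2 * π * Complex.I *
          toDist (𝓕 u) (SchwartzMap.smulLeftCLM ℂ (fun x : R3 => ((inner ℝ x e : ℝ) : ℂ)) φ) := by
        rw [TemperedDistribution.fourier_lineDerivOp_eq, fourier_toDist]
        rfl
    _ = ∫ ξ, φ ξ * (2 * π * Complex.I * ξ i * (𝓕 u : L2) ξ) := by
        rw [toDist_apply, ← integral_const_mul]
        refine integral_congr_ae (ae_of_all _ fun ξ => ?_)
        simp only
        rw [SchwartzMap.smulLeftCLM_apply_apply htg, hcoord, smul_eq_mul]
        ring

lemma HasGradient.ofReal_norm_sq (h : HasGradient u g) (i : Fin 3) :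
    ENNReal.ofReal (‖g i‖ ^ 2) =
      ∫⁻ ξ, ENNReal.ofReal (4 * π ^ 2 * ξ i ^ 2) * ‖(𝓕 u : L2) ξ‖ₑ ^ 2 := by
  rw [← lintegral_enorm_fourier_sq]
  refine lintegral_congr_ae ?_
  filter_upwards [h.coe_fourier i] with ξ hξ
  rw [hξ, enorm_mul, mul_pow, ← ofReal_norm, ← ENNReal.ofReal_pow (norm_nonneg _)]
  congr 2
  simp only [norm_mul, Complex.norm_ofNat, Complex.norm_real, Complex.norm_I, mul_pow,
    Real.norm_eq_abs, sq_abs]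
  ring

lemma HasGradient.energy_eq (h : HasGradient u g) {l : ℝ} (hl : 0 ≤ l) :
    energy l u = ENNReal.ofReal ((∑ i, ‖g i‖ ^ 2) + l * ‖u‖ ^ 2) := by
  have : Measurable (𝓕 u : L2) := (Lp.stronglyMeasurable _).measurable
  rw [ENNReal.ofReal_add (by positivity) (by positivity), ENNReal.ofReal_mul hl,
    ← lintegral_enorm_fourier_sq,
    ENNReal.ofReal_sum_of_nonneg fun i _ => by positivity,
    Finset.sum_congr rfl fun i _ => h.ofReal_norm_sq i,
    ← lintegral_finsetSum _ fun i _ => by fun_prop, ← lintegral_const_mul _ (by fun_prop),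
    ← lintegral_add_left (by fun_prop)]
  refine lintegral_congr fun ξ => ?_
  rw [← Finset.sum_mul, ← add_mul, ← ENNReal.ofReal_sum_of_nonneg fun i _ => by positivity,
    ← ENNReal.ofReal_add (Finset.sum_nonneg fun i _ => by positivity) hl, ← Finset.mul_sum,
    ← EuclideanSpace.real_norm_sq_eq, laplacianSymbol]

end Energy

section KatoFormBound

variable {V : R3 → ℝ}

theorem KatoClass.eventually_lintegral_mul_enorm_sq_le (hV : KatoClass V) {ε : ℝ≥0∞}
    (hε : 0 < ε) :
    ∀ᶠ l : ℝ in atTop, ∀ u : L2, ∫⁻ x, ‖V x‖ₑ * ‖u x‖ₑ ^ 2 ≤ ε * energy l u := by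
  filter_upwards [eventually_gt_atTop 0, hV.eventually_lintegral_resolventKernel_le hε]
    with l hl hM using lintegral_mul_enorm_sq_le hV.1 hl hM

theorem KatoClass.eventually_formBound (hV : KatoClass V) : ∀ᶠ a in atTop, FormBound V a := by
  filter_upwards [eventually_ge_atTop 0,
    hV.eventually_lintegral_mul_enorm_sq_le (ε := ENNReal.ofReal (1 / 2)) (by simp)]
    with a ha hbound u _ g hg
  set N := 1 / 2 * ((∑ i, ‖g i‖ ^ 2) + a * ‖u‖ ^ 2)
  have hle : ∫⁻ x, ‖V x * ‖u x‖ ^ 2‖ₑ ≤ ENNReal.ofReal N := by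
    simp only [N, enorm_mul, enorm_pow, enorm_norm]
    rw [ENNReal.ofReal_mul (by norm_num), ← hg.energy_eq ha]
    exact hbound u
  have : Measurable u := (Lp.stronglyMeasurable u).measurable
  have hint : Integrable fun x => V x * ‖u x‖ ^ 2 :=
    ⟨(hV.1.mul (by fun_prop)).aestronglyMeasurable, hle.trans_lt ENNReal.ofReal_lt_top⟩
  have habs : |∫ x, V x * ‖u x‖ ^ 2| ≤ N := by
    rw [← Real.norm_eq_abs, ← ENNReal.ofReal_le_ofReal_iff (by positivity), ofReal_norm]
    exact (enorm_integral_le_lintegral_enorm _).trans hle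
  have hmass : 0 ≤ a * ‖u‖ ^ 2 := by positivity
  obtain ⟨hlower, hupper⟩ := abs_le.mp habs
  refine ⟨hint, ?_, ?_⟩ <;> simp only [N] at hlower hupper <;> linarith

end KatoFormBound

section BesselSymbol

variable {E : Type*} [NormedAddCommGroup E]

/-- The symbol `(1 + |ξ|²)^{s/2}` of the Bessel potential of order `s`, in the normalization of
`TemperedDistribution.besselPotential`. -/
def besselSymbol (s : ℝ) (ξ : E) : ℂ := ((1 + ‖ξ‖ ^ 2) ^ (s / 2) : ℝ)

lemma conj_besselSymbol (s : ℝ) (ξ : E) : conj (besselSymbol s ξ) = besselSymbol s ξ :=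
  Complex.conj_ofReal _

lemma besselSymbol_neg_mul_besselSymbol (s : ℝ) (ξ : E) :
    besselSymbol (-s) ξ * besselSymbol s ξ = 1 := by
  rw [besselSymbol, besselSymbol, ← Complex.ofReal_mul, ← Real.rpow_add (by positivity)]
  simp [neg_div]

lemma norm_besselSymbol_le_one {s : ℝ} (hs : s ≤ 0) (ξ : E) : ‖besselSymbol s ξ‖ ≤ 1 := by
  rw [besselSymbol, Complex.norm_real, Real.norm_of_nonneg (by positivity)]
  exact Real.rpow_le_one_of_one_le_of_nonpos (le_add_of_nonneg_right (by positivity))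
    (by linarith)

lemma norm_besselSymbol_neg_one_sq (ξ : E) : ‖besselSymbol (-1) ξ‖ ^ 2 = (1 + ‖ξ‖ ^ 2)⁻¹ := by
  rw [besselSymbol, Complex.norm_real, Real.norm_of_nonneg (by positivity),
    ← Real.rpow_mul_natCast (by positivity), ← Real.rpow_neg_one]
  norm_num

variable [InnerProductSpace ℝ E]

lemma hasTemperateGrowth_besselSymbol (s : ℝ) : (besselSymbol (E := E) s).HasTemperateGrowth := by
  unfold besselSymbol
  fun_prop

variable [FiniteDimensional ℝ E] [MeasurableSpace E] [BorelSpace E]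

lemma memLp_top_besselSymbol {s : ℝ} (hs : s ≤ 0) : MemLp (besselSymbol (E := E) s) ∞ volume :=
  memLp_top_of_bound (hasTemperateGrowth_besselSymbol s).1.continuous.aestronglyMeasurable 1
    (ae_of_all _ (norm_besselSymbol_le_one hs))

end BesselSymbol

section BesselPotential

/-- The Bessel potential `(1 + |ξ|²)^{-1/2}` as a bounded Fourier multiplier on `L²(ℝ³)`. It maps
`L²` bijectively onto `H¹`, which turns the form of `𝓗` into a bounded form on `L²`. -/
def besselOp : L2 →L[ℂ] L2 :=
  fourierInvCLM ℂ L2 ∘L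
    (ContinuousLinearMap.mul ℂ ℂ).holderL volume ∞ 2 2
      ((memLp_top_besselSymbol (E := R3) (s := -1) (by norm_num)).toLp _) ∘L
    fourierCLM ℂ L2

lemma coe_fourier_besselOp (h : L2) :
    (𝓕 (besselOp h) : L2) =ᵐ[volume] fun ξ => besselSymbol (-1) ξ * (𝓕 h : L2) ξ := by
  have hm := memLp_top_besselSymbol (E := R3) (s := -1) (by norm_num)
  have hfourier : 𝓕 (besselOp h) =
      (ContinuousLinearMap.mul ℂ ℂ).holder 2 (hm.toLp _) (𝓕 h : L2) := fourier_fourierInv_eq _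
  rw [hfourier]
  filter_upwards [(ContinuousLinearMap.mul ℂ ℂ).coeFn_holder (r := 2) (hm.toLp _) (𝓕 h : L2),
    hm.coeFn_toLp] with ξ hprod hsymbol
  rw [hprod, hsymbol, ContinuousLinearMap.mul_apply']

lemma toDist_besselOp (h : L2) :
    toDist (besselOp h) = TemperedDistribution.besselPotential R3 ℂ (-1) (toDist h) := by
  suffices hfourier : 𝓕 (toDist (besselOp h)) =
      𝓕 (TemperedDistribution.besselPotential R3 ℂ (-1) (toDist h)) by
    rw [← fourierInv_fourier_eq (F := 𝓢'(R3, ℂ)) (toDist (besselOp h)), hfourier,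
      fourierInv_fourier_eq]
  rw [TemperedDistribution.fourier_besselPotential_eq_smulLeftCLM_fourier_apply, fourier_toDist,
    fourier_toDist]
  ext φ
  change _ = toDist (𝓕 h) (SchwartzMap.smulLeftCLM ℂ (besselSymbol (-1)) φ)
  rw [toDist_apply, toDist_apply]
  refine integral_congr_ae ?_
  filter_upwards [coe_fourier_besselOp h] with ξ hξ
  rw [hξ, SchwartzMap.smulLeftCLM_apply_apply (hasTemperateGrowth_besselSymbol _), smul_eq_mul]
  ring

lemma besselPotential_one_toDist_besselOp (h : L2) :
    TemperedDistribution.besselPotential R3 ℂ 1 (toDist (besselOp h)) = toDist h := by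
  rw [toDist_besselOp, TemperedDistribution.besselPotential_besselPotential_apply]
  simp

lemma besselPotential_one_toDist_injective :
    Function.Injective fun h => TemperedDistribution.besselPotential R3 ℂ 1 (toDist h) := by
  intro h k hhk
  rw [← TemperedDistribution.besselPotential_neg_apply_eq_iff,
    TemperedDistribution.besselPotential_besselPotential_apply] at hhk
  exact toDist_injective (by simpa using hhk.symm)

lemma range_besselOp : range besselOp = H1 := by
  ext u
  refine exists_congr fun h => ?_
  change _ ↔ TemperedDistribution.besselPotential R3 ℂ 1 (toDist u) = toDist h
  rw [← TemperedDistribution.besselPotential_neg_apply_eq_iff, ← toDist_besselOp]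
  exact toDist_injective.eq_iff.symm

lemma besselOp_mem_H1 (h : L2) : besselOp h ∈ H1 := range_besselOp ▸ mem_range_self h

lemma range_besselPotential_one_toDist :
    range (fun h => TemperedDistribution.besselPotential R3 ℂ 1 (toDist h)) = Hneg1 := by
  ext T
  exact exists_congr fun h =>
    (TemperedDistribution.besselPotential_neg_apply_eq_iff 1 T (toDist h)).symm

lemma isSelfAdjoint_besselOp : IsSelfAdjoint besselOp := by
  refine ContinuousLinearMap.isSelfAdjoint_iff_isSymmetric.mpr fun h k => ?_
  change inner ℂ (besselOp h) k = inner ℂ h (besselOp k)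
  rw [← Lp.inner_fourier_eq, ← Lp.inner_fourier_eq h, inner_eq_integral, inner_eq_integral]
  refine integral_congr_ae ?_
  filter_upwards [coe_fourier_besselOp h, coe_fourier_besselOp k] with ξ hξ kξ
  rw [hξ, kξ, map_mul, conj_besselSymbol]
  ring

end BesselPotential

section BesselGradient

lemma energy_besselOp (h : L2) :
    energy (4 * π ^ 2) (besselOp h) = ENNReal.ofReal (4 * π ^ 2 * ‖h‖ ^ 2) := by
  rw [energy, ENNReal.ofReal_mul (by positivity), ← lintegral_enorm_fourier_sq,
    ← lintegral_const_mul' _ _ ENNReal.ofReal_ne_top]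
  refine lintegral_congr_ae ?_
  filter_upwards [coe_fourier_besselOp h] with ξ hξ
  rw [hξ, enorm_mul, mul_pow, ← ofReal_norm (besselSymbol _ _),
    ← ENNReal.ofReal_pow (norm_nonneg _), norm_besselSymbol_neg_one_sq, laplacianSymbol,
    ← mul_assoc, ← ENNReal.ofReal_mul (by positivity)]
  congr 2
  field_simp
  ring

lemma HasGradient.sum_norm_sq_besselOp {h : L2} {g : Fin 3 → L2}
    (hg : HasGradient (besselOp h) g) :
    ∑ i, ‖g i‖ ^ 2 = 4 * π ^ 2 * (‖h‖ ^ 2 - ‖besselOp h‖ ^ 2) := by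
  have henergy := hg.energy_eq (l := 4 * π ^ 2) (by positivity)
  rw [energy_besselOp, ENNReal.ofReal_eq_ofReal_iff (by positivity) (by positivity)] at henergy
  linarith

lemma norm_besselOp_le (h : L2) : ‖besselOp h‖ ≤ ‖h‖ := by
  obtain ⟨g, hg⟩ := exists_hasGradient (besselOp_mem_H1 h)
  have hsum : 0 ≤ 4 * π ^ 2 * (‖h‖ ^ 2 - ‖besselOp h‖ ^ 2) :=
    hg.sum_norm_sq_besselOp ▸ Finset.sum_nonneg fun i _ => by positivity
  have hsq : 0 ≤ ‖h‖ ^ 2 - ‖besselOp h‖ ^ 2 := nonneg_of_mul_nonneg_right hsum (by positivity)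
  exact le_of_sq_le_sq (by linarith) (norm_nonneg _)

end BesselGradient

section FourierIdentities

variable {E : Type*} [NormedAddCommGroup E] [InnerProductSpace ℝ E] [FiniteDimensional ℝ E]
  [MeasurableSpace E] [BorelSpace E]

lemma besselPotential_two (T : 𝓢'(E, ℂ)) :
    TemperedDistribution.besselPotential E ℂ 2 T =
      T + TemperedDistribution.fourierMultiplierCLM ℂ
        (fun x : E => Complex.ofReal (‖x‖ ^ 2)) T := by
  have hsymbol : (fun x : E => (((1 + ‖x‖ ^ 2) ^ ((2 : ℝ) / 2) : ℝ) : ℂ)) =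
      (fun _ : E => (1 : ℂ)) + fun x : E => Complex.ofReal (‖x‖ ^ 2) := by
    ext x
    simp
  rw [TemperedDistribution.besselPotential, hsymbol,
    TemperedDistribution.fourierMultiplierCLM_apply,
    TemperedDistribution.smulLeftCLM_add (by fun_prop) (by fun_prop), add_apply,
    fourierInv_add, TemperedDistribution.smulLeftCLM_const, one_smul,
    TemperedDistribution.fourierMultiplierCLM_apply, fourierInv_fourier_eq]

lemma neg_laplacian_eq_besselPotential_two (T : 𝓢'(E, ℂ)) :
    -Δ T = ((4 * π ^ 2 : ℝ) : ℂ) • (TemperedDistribution.besselPotential E ℂ 2 T - T) := by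
  rw [besselPotential_two, add_sub_cancel_left,
    TemperedDistribution.laplacian_eq_fourierMultiplierCLM, neg_smul, neg_neg]
  ext φ
  change ((2 * π) ^ 2 : ℝ) • TemperedDistribution.fourierMultiplierCLM ℂ _ T φ =
    ((4 * π ^ 2 : ℝ) : ℂ) • TemperedDistribution.fourierMultiplierCLM ℂ _ T φ
  rw [Complex.real_smul, smul_eq_mul]
  push_cast
  ring

lemma fourier_star_toLp (φ : 𝓢(E, ℂ)) :
    𝓕 (star (φ.toLp 2 : Lp ℂ 2 (volume : Measure E))) = star ((𝓕⁻ φ).toLp 2) := by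
  have hstar : Integrable (star (φ : E → ℂ)) :=
    (Complex.conjLIE.toContinuousLinearEquiv.integrable_comp_iff).mpr φ.integrable
  have hstar_toLp : star (φ.toLp 2 : Lp ℂ 2 (volume : Measure E)) =
      (φ.memLp 2 volume).star.toLp _ := rfl
  refine Lp.ext ?_
  rw [hstar_toLp]
  filter_upwards [coe_fourier_toLp hstar (φ.memLp 2 volume).star,
    Lp.coeFn_star ((𝓕⁻ φ).toLp 2 : Lp ℂ 2 volume), (𝓕⁻ φ).coeFn_toLp 2]
    with x hfourier hcoe hinv
  rw [hfourier, hcoe, Pi.star_apply, hinv, SchwartzMap.fourierInv_coe, Real.fourier_eq',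
    Real.fourierInv_eq', RCLike.star_def, ← integral_conj]
  refine integral_congr_ae (ae_of_all _ fun y => ?_)
  simp only [smul_eq_mul, map_mul, ← Complex.exp_conj, Complex.conj_ofReal, Complex.conj_I,
    Pi.star_apply, RCLike.star_def]
  push_cast
  ring_nf

end FourierIdentities

section BesselDistributions

lemma neg_laplacian_toDist_besselOp (h : L2) :
    -Δ (toDist (besselOp h)) = TemperedDistribution.besselPotential R3 ℂ 1
      (toDist (((4 * π ^ 2 : ℝ) : ℂ) • (h - besselOp (besselOp h)))) := by
  have hlift : TemperedDistribution.besselPotential R3 ℂ 2 (toDist (besselOp h)) =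
      TemperedDistribution.besselPotential R3 ℂ 1 (toDist h) := by
    rw [← besselPotential_one_toDist_besselOp h,
      TemperedDistribution.besselPotential_besselPotential_apply, one_add_one_eq_two]
  rw [neg_laplacian_eq_besselPotential_two, hlift, toDist_smul, map_smul, toDist_sub, map_sub,
    besselPotential_one_toDist_besselOp]

lemma besselOp_star_fourier_toLp (φ : 𝓢(R3, ℂ)) :
    besselOp (star ((𝓕 (SchwartzMap.smulLeftCLM ℂ (besselSymbol 1) (𝓕⁻ φ))).toLp 2)) =
      star (φ.toLp 2) := by
  set χ := SchwartzMap.smulLeftCLM ℂ (besselSymbol 1) (𝓕⁻ φ)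
  refine (Lp.fourierTransformₗᵢ R3 ℂ).injective ?_
  change (𝓕 (besselOp _) : L2) = 𝓕 (star (φ.toLp 2) : L2)
  have hsymbol := coe_fourier_besselOp (star ((𝓕 χ).toLp 2))
  rw [fourier_star_toLp, fourierInv_fourier_eq] at hsymbol
  rw [fourier_star_toLp]
  refine Lp.ext ?_
  filter_upwards [hsymbol, Lp.coeFn_star (χ.toLp 2 : L2), χ.coeFn_toLp 2,
    Lp.coeFn_star ((𝓕⁻ φ).toLp 2 : L2), (𝓕⁻ φ).coeFn_toLp 2] with x hx hχstar hχ hφstar hφ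
  rw [hx, hχstar, hφstar, Pi.star_apply, Pi.star_apply, hχ, hφ,
    SchwartzMap.smulLeftCLM_apply_apply (hasTemperateGrowth_besselSymbol _), smul_eq_mul,
    RCLike.star_def, map_mul, conj_besselSymbol, ← mul_assoc, besselSymbol_neg_mul_besselSymbol,
    one_mul]

lemma inner_star_toLp (φ : 𝓢(R3, ℂ)) (g : L2) :
    inner ℂ (star (φ.toLp 2 : L2)) g = toDist g φ := by
  rw [inner_eq_integral, toDist_apply]
  refine integral_congr_ae ?_
  filter_upwards [Lp.coeFn_star (φ.toLp 2 : L2), φ.coeFn_toLp 2] with x hstar hφ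
  rw [hstar, Pi.star_apply, hφ, RCLike.star_def, Complex.conj_conj]

-- The duality between `H⁻¹` and `H¹`: a test function is the conjugate of `besselOp f`, and the
-- Bessel potential of order one is the transpose of the inverse of `besselOp`.
lemma exists_besselOp_eq_star_toLp (φ : 𝓢(R3, ℂ)) :
    ∃ f : L2, besselOp f = star (φ.toLp 2) ∧
      ∀ g : L2, TemperedDistribution.besselPotential R3 ℂ 1 (toDist g) φ = inner ℂ f g :=
  ⟨_, besselOp_star_fourier_toLp φ, fun g => (inner_star_toLp _ g).symm⟩

end BesselDistributions

section SesquilinearForms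

variable {E : Type*} [NormedAddCommGroup E] [InnerProductSpace ℂ E]

lemma sesqForm_polarization (B : E →ₗ⋆[ℂ] E →ₗ[ℂ] ℂ) (x y : E) :
    B x y = (B (x + y) (x + y) - B (x - y) (x - y) +
      (B (x - Complex.I • y) (x - Complex.I • y) - B (x + Complex.I • y) (x + Complex.I • y)) *
        Complex.I) / 4 := by
  simp only [map_add, map_sub, LinearMap.map_smulₛₗ, LinearMap.add_apply, LinearMap.sub_apply,
    LinearMap.smul_apply, smul_eq_mul, Complex.conj_I, RingHom.id_apply]
  linear_combination ((B x y - B y x) / 2) * Complex.I_mul_I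

lemma norm_sesqForm_le_add {B : E →ₗ⋆[ℂ] E →ₗ[ℂ] ℂ} {C : ℝ} (hB : ∀ x, ‖B x x‖ ≤ C * ‖x‖ ^ 2)
    (x y : E) : ‖B x y‖ ≤ C * (‖x‖ ^ 2 + ‖y‖ ^ 2) := by
  have hparallelogram : ∀ z : E, ‖x + z‖ ^ 2 + ‖x - z‖ ^ 2 = 2 * (‖x‖ ^ 2 + ‖z‖ ^ 2) := fun z => by
    simpa only [sq] using parallelogram_law_with_norm ℂ x z
  have hy := hparallelogram y
  have hIy := hparallelogram (Complex.I • y)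
  rw [norm_smul, Complex.norm_I, one_mul] at hIy
  rw [sesqForm_polarization B x y, norm_div, Complex.norm_ofNat, div_le_iff₀ four_pos]
  refine (norm_add_le _ _).trans ?_
  rw [norm_mul, Complex.norm_I, mul_one]
  linarith [norm_sub_le (B (x + y) (x + y)) (B (x - y) (x - y)),
    norm_sub_le (B (x - Complex.I • y) (x - Complex.I • y))
      (B (x + Complex.I • y) (x + Complex.I • y)),
    hB (x + y), hB (x - y), hB (x - Complex.I • y), hB (x + Complex.I • y),
    congrArg (C * ·) hy, congrArg (C * ·) hIy]

lemma norm_sesqForm_le {B : E →ₗ⋆[ℂ] E →ₗ[ℂ] ℂ} {C : ℝ} (hB : ∀ x, ‖B x x‖ ≤ C * ‖x‖ ^ 2)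
    (x y : E) : ‖B x y‖ ≤ 2 * C * ‖x‖ * ‖y‖ := by
  rcases eq_or_ne x 0 with rfl | hx
  · simp
  rcases eq_or_ne y 0 with rfl | hy
  · simp
  have hunit : ∀ z : E, z ≠ 0 → ‖((‖z‖⁻¹ : ℝ) : ℂ) • z‖ = 1 := fun z hz => by
    rw [norm_smul, Complex.norm_real, norm_inv, norm_norm,
      inv_mul_cancel₀ (norm_ne_zero_iff.mpr hz)]
  have hle := norm_sesqForm_le_add hB (((‖x‖⁻¹ : ℝ) : ℂ) • x) (((‖y‖⁻¹ : ℝ) : ℂ) • y)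
  rw [hunit x hx, hunit y hy, LinearMap.map_smulₛₗ, LinearMap.map_smulₛₗ,
    LinearMap.smul_apply, smul_eq_mul, smul_eq_mul, RingHom.id_apply, Complex.conj_ofReal,
    norm_mul, norm_mul, Complex.norm_real, Complex.norm_real, norm_inv, norm_inv, norm_norm,
    norm_norm] at hle
  have := norm_pos_iff.mpr hx
  have := norm_pos_iff.mpr hy
  calc ‖B x y‖ = ‖y‖⁻¹ * (‖x‖⁻¹ * ‖B x y‖) * ‖x‖ * ‖y‖ := by field_simp
    _ ≤ C * (1 ^ 2 + 1 ^ 2) * ‖x‖ * ‖y‖ := by gcongr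
    _ = 2 * C * ‖x‖ * ‖y‖ := by ring

lemma exists_isSelfAdjoint_inner_eq [CompleteSpace E] {B : E →ₗ⋆[ℂ] E →ₗ[ℂ] ℂ}
    (hsymm : ∀ x y, conj (B x y) = B y x) {C : ℝ} (hB : ∀ x, ‖B x x‖ ≤ C * ‖x‖ ^ 2) :
    ∃ Q : E →L[ℂ] E, IsSelfAdjoint Q ∧ ∀ x y, inner ℂ x (Q y) = B x y := by
  set Q := InnerProductSpace.continuousLinearMapOfBilin
    (B.mkContinuous₂ (2 * C) (norm_sesqForm_le hB))
  have hQ : ∀ x y, inner ℂ (Q x) y = B x y :=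
    InnerProductSpace.continuousLinearMapOfBilin_apply _
  have hQ' : ∀ x y, inner ℂ x (Q y) = B x y := fun x y => by
    rw [← inner_conj_symm, hQ, hsymm]
  refine ⟨Q, ContinuousLinearMap.isSelfAdjoint_iff_isSymmetric.mpr fun x y => ?_, hQ'⟩
  exact (hQ x y).trans (hQ' x y).symm

end SesquilinearForms

section PotentialForm

variable {V : R3 → ℝ} {a : ℝ}

lemma coe_besselOp_add (h k : L2) :
    besselOp (h + k) =ᵐ[volume] fun x => besselOp h x + besselOp k x := by
  rw [map_add]
  exact Lp.coeFn_add _ _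

lemma coe_besselOp_smul (c : ℂ) (h : L2) :
    besselOp (c • h) =ᵐ[volume] fun x => c * besselOp h x := by
  rw [map_smul]
  exact Lp.coeFn_smul _ _

lemma FormBound.integrable_mul_norm_besselOp_sq (ha : FormBound V a) (h : L2) :
    Integrable fun x => V x * ‖besselOp h x‖ ^ 2 := by
  obtain ⟨g, hg⟩ := exists_hasGradient (besselOp_mem_H1 h)
  exact (ha _ (besselOp_mem_H1 h) g hg).1

lemma FormBound.abs_integral_mul_norm_besselOp_sq_le (ha : FormBound V a) (h : L2) :
    |∫ x, V x * ‖besselOp h x‖ ^ 2| ≤ (2 * π ^ 2 + |a|) * ‖h‖ ^ 2 := by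
  obtain ⟨g, hg⟩ := exists_hasGradient (besselOp_mem_H1 h)
  obtain ⟨-, hlower, hupper⟩ := ha _ (besselOp_mem_H1 h) g hg
  rw [hg.sum_norm_sq_besselOp] at hlower hupper
  have hmass : a * ‖besselOp h‖ ^ 2 ≤ |a| * ‖h‖ ^ 2 := by
    gcongr
    · exact le_abs_self a
    · exact norm_besselOp_le h
  have hpi : 0 ≤ π ^ 2 * ‖besselOp h‖ ^ 2 := by positivity
  rw [abs_le]
  constructor <;> linarith

-- Polarization: `4 z̄ w = ∑ c̄ |z + c w|²` over `c ∈ {1, -1, i, -i}`.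
lemma FormBound.integrable_mul_conj_besselOp_mul (ha : FormBound V a) (h k : L2) :
    Integrable fun x => (V x : ℂ) * (conj (besselOp h x) * besselOp k x) := by
  set G : ℂ → R3 → ℂ := fun c x => ((V x * ‖besselOp (h + c • k) x‖ ^ 2 : ℝ) : ℂ)
  have hG : ∀ c, Integrable (G c) := fun c => (ha.integrable_mul_norm_besselOp_sq _).ofReal
  have hGeq : ∀ c, ∀ᵐ x, G c x = V x * (conj (besselOp h x + c * besselOp k x) *
      (besselOp h x + c * besselOp k x)) := fun c => by
    filter_upwards [coe_besselOp_add h (c • k), coe_besselOp_smul c k] with x hadd hsmul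
    simp only [G, hadd, hsmul]
    rw [Complex.conj_mul', Complex.ofReal_mul, Complex.ofReal_pow]
  refine ((((hG 1).sub (hG (-1))).add
    (((hG (-Complex.I)).sub (hG Complex.I)).mul_const Complex.I)).div_const 4).congr ?_
  filter_upwards [hGeq 1, hGeq (-1), hGeq Complex.I, hGeq (-Complex.I)] with x h₁ h₂ h₃ h₄
  simp only [Pi.add_apply, Pi.sub_apply, h₁, h₂, h₃, h₄, map_add, map_mul, map_neg, map_one,
    Complex.conj_I]
  linear_combination (-(V x : ℂ) * (conj (besselOp h x) * besselOp k x -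
    conj (besselOp k x) * besselOp h x) / 2) * Complex.I_mul_I

/-- The form `∫ V ū v` on `H¹`, pulled back to `L²` along `besselOp`. -/
def potentialForm (ha : FormBound V a) : L2 →ₗ⋆[ℂ] L2 →ₗ[ℂ] ℂ :=
  LinearMap.mk₂'ₛₗ _ _ (fun h k => ∫ x, (V x : ℂ) * (conj (besselOp h x) * besselOp k x))
    (fun h h' k => by
      rw [← integral_add (ha.integrable_mul_conj_besselOp_mul h k)
        (ha.integrable_mul_conj_besselOp_mul h' k)]
      refine integral_congr_ae ((coe_besselOp_add h h').mono fun x hx => ?_)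
      simp only [hx]
      rw [map_add]
      ring)
    (fun c h k => by
      rw [smul_eq_mul, ← integral_const_mul]
      refine integral_congr_ae ((coe_besselOp_smul c h).mono fun x hx => ?_)
      simp only [hx, map_mul]
      ring)
    (fun h k k' => by
      rw [← integral_add (ha.integrable_mul_conj_besselOp_mul h k)
        (ha.integrable_mul_conj_besselOp_mul h k')]
      refine integral_congr_ae ((coe_besselOp_add k k').mono fun x hx => ?_)
      simp only [hx]
      ring)
    (fun c h k => by
      rw [smul_eq_mul, RingHom.id_apply, ← integral_const_mul]
      refine integral_congr_ae ((coe_besselOp_smul c k).mono fun x hx => ?_)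
      simp only [hx]
      ring)

lemma potentialForm_apply (ha : FormBound V a) (h k : L2) :
    potentialForm ha h k = ∫ x, (V x : ℂ) * (conj (besselOp h x) * besselOp k x) := rfl

lemma potentialForm_apply_self (ha : FormBound V a) (h : L2) :
    potentialForm ha h h = ((∫ x, V x * ‖besselOp h x‖ ^ 2 : ℝ) : ℂ) := by
  rw [potentialForm_apply, ← integral_complex_ofReal]
  refine integral_congr_ae (ae_of_all _ fun x => ?_)
  simp only
  rw [Complex.conj_mul', Complex.ofReal_mul, Complex.ofReal_pow]

lemma conj_potentialForm (ha : FormBound V a) (h k : L2) :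
    conj (potentialForm ha h k) = potentialForm ha k h := by
  rw [potentialForm_apply, potentialForm_apply, ← integral_conj]
  refine integral_congr_ae (ae_of_all _ fun x => ?_)
  simp only [map_mul, Complex.conj_ofReal, Complex.conj_conj]
  ring

lemma exists_potentialOp (ha : FormBound V a) :
    ∃ Q : L2 →L[ℂ] L2, IsSelfAdjoint Q ∧ ∀ h k, inner ℂ h (Q k) = potentialForm ha h k := by
  refine exists_isSelfAdjoint_inner_eq (conj_potentialForm ha) (C := 2 * π ^ 2 + |a|) fun h => ?_
  rw [potentialForm_apply_self, Complex.norm_real, Real.norm_eq_abs]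
  exact ha.abs_integral_mul_norm_besselOp_sq_le h

lemma isRegular_potential_besselOp (ha : FormBound V a) {k q : L2}
    (hq : ∀ h, inner ℂ h q = potentialForm ha h k) :
    IsRegular (potential V (besselOp k))
      (TemperedDistribution.besselPotential R3 ℂ 1 (toDist q)) := by
  intro φ
  obtain ⟨f, hf, hpairing⟩ := exists_besselOp_eq_star_toLp φ
  have hae : (fun x => (V x : ℂ) * (conj (besselOp f x) * besselOp k x)) =ᵐ[volume]
      fun x => φ x * potential V (besselOp k) x := by
    rw [hf]
    filter_upwards [Lp.coeFn_star (φ.toLp 2 : L2), φ.coeFn_toLp 2] with x hstar hφ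
    rw [hstar, Pi.star_apply, hφ, RCLike.star_def, Complex.conj_conj, potential]
    ring
  refine ⟨(ha.integrable_mul_conj_besselOp_mul f k).congr hae, ?_⟩
  rw [hpairing, hq, potentialForm_apply, integral_congr_ae hae]

theorem FormBound.isRegular_potential (ha : FormBound V a) {u : L2} (hu : u ∈ H1) :
    IsRegular (potential V u) (regular (potential V u)) := by
  obtain ⟨k, rfl⟩ := range_besselOp ▸ hu
  obtain ⟨Q, -, hQ⟩ := exists_potentialOp ha
  exact (isRegular_potential_besselOp ha fun h => hQ h k).isRegular_regular

end PotentialForm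

section SelfAdjointCriterion

variable {𝕜 E : Type*} [RCLike 𝕜] [NormedAddCommGroup E] [InnerProductSpace 𝕜 E]

lemma inner_add_smul_of_isFormalAdjoint {A : E →ₗ.[𝕜] E} (hA : A.IsFormalAdjoint A) (c : ℝ)
    (u v : A.domain) :
    inner 𝕜 (A u + (c : 𝕜) • (u : E)) v = inner 𝕜 (u : E) (A v + (c : 𝕜) • (v : E)) := by
  rw [inner_add_left, inner_add_right, inner_smul_left, inner_smul_right, RCLike.conj_ofReal, hA]

lemma dense_domain_of_surjective_add_smul [CompleteSpace E] {A : E →ₗ.[𝕜] E}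
    (hA : A.IsFormalAdjoint A) {c : ℝ}
    (hsurj : Function.Surjective fun u : A.domain => A u + (c : 𝕜) • (u : E)) :
    Dense (A.domain : Set E) := by
  rw [Submodule.dense_iff_topologicalClosure_eq_top, Submodule.topologicalClosure_eq_top_iff,
    Submodule.eq_bot_iff]
  intro v hv
  obtain ⟨w, rfl⟩ := hsurj v
  have hw : w = 0 := by
    refine Subtype.ext (ext_inner_left 𝕜 fun z => ?_)
    obtain ⟨u, rfl⟩ := hsurj z
    rw [inner_add_smul_of_isFormalAdjoint hA, (Submodule.mem_orthogonal _ _).mp hv u u.2,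
      ZeroMemClass.coe_zero, inner_zero_right]
  simp [hw]

theorem isSelfAdjoint_of_surjective_add_smul [CompleteSpace E] {A : E →ₗ.[𝕜] E}
    (hA : A.IsFormalAdjoint A) {c : ℝ}
    (hsurj : Function.Surjective fun u : A.domain => A u + (c : 𝕜) • (u : E)) :
    IsSelfAdjoint A := by
  have hdense := dense_domain_of_surjective_add_smul hA hsurj
  have hle : A ≤ A.adjoint := LinearPMap.IsFormalAdjoint.le_adjoint hdense hA
  refine (LinearPMap.eq_of_le_of_domain_eq hle (le_antisymm hle.1 fun v hv => ?_)).symm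
  obtain ⟨w, hw⟩ := hsurj (A.adjoint ⟨v, hv⟩ + (c : 𝕜) • v)
  have hvw : v = w := by
    refine ext_inner_left 𝕜 fun z => ?_
    obtain ⟨u, rfl⟩ := hsurj z
    have hadjoint : inner 𝕜 (A u) v = inner 𝕜 (u : E) (A.adjoint ⟨v, hv⟩) :=
      (LinearPMap.adjoint_isFormalAdjoint hdense).symm u ⟨v, hv⟩
    simp only at hw
    rw [inner_add_smul_of_isFormalAdjoint hA, hw, inner_add_left, inner_add_right,
      inner_smul_left, inner_smul_right, RCLike.conj_ofReal, hadjoint]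
  exact hvw ▸ w.2

lemma exists_isSelfAdjoint_inverse_sub [CompleteSpace E] {K : E →ₗ[𝕜] E} (hK : K.IsSymmetric)
    (hinj : Function.Injective K) (c : ℝ) :
    ∃ A : E →ₗ.[𝕜] E, A.domain = LinearMap.range K ∧
      (∀ u : A.domain, K (A u + (c : 𝕜) • (u : E)) = u) ∧ IsSelfAdjoint A := by
  set e := LinearEquiv.ofInjective K hinj
  set A : E →ₗ.[𝕜] E := ⟨LinearMap.range K,
    (e.symm : LinearMap.range K →ₗ[𝕜] E) - (c : 𝕜) • (LinearMap.range K).subtype⟩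
  have hshift : ∀ u : A.domain, A u + (c : 𝕜) • (u : E) = e.symm u := fun u => sub_add_cancel _ _
  have hright : ∀ u : A.domain, K (e.symm u) = u := fun u =>
    congrArg Subtype.val (e.apply_symm_apply u)
  have hformal : A.IsFormalAdjoint A := fun u v => by
    have hsymm : inner 𝕜 (A u + (c : 𝕜) • (u : E)) v =
        inner 𝕜 (u : E) (A v + (c : 𝕜) • (v : E)) := by
      rw [hshift, hshift, ← hright u, ← hright v, hK]
    rwa [inner_add_left, inner_add_right, inner_smul_left, inner_smul_right, RCLike.conj_ofReal,
      add_left_inj] at hsymm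
  refine ⟨A, rfl, fun u => by rw [hshift, hright], isSelfAdjoint_of_surjective_add_smul (c := c)
    hformal fun x => ⟨e x, ?_⟩⟩
  exact (hshift (e x)).trans (e.symm_apply_apply x)

end SelfAdjointCriterion

section Hamiltonian

variable {V : R3 → ℝ} {a : ℝ}

/-- The bounded operator `R (𝓗 + a + 1) R` on `L²`, where `R` is `besselOp` and `Q` is the
operator `R V R` of the potential. -/
def conjugatedOp (a : ℝ) (Q : L2 →L[ℂ] L2) : L2 →L[ℂ] L2 :=
  ((4 * π ^ 2 : ℝ) : ℂ) • (1 - besselOp * besselOp) + ((a + 1 : ℝ) : ℂ) • (besselOp * besselOp) + Q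

lemma isSelfAdjoint_conjugatedOp (a : ℝ) {Q : L2 →L[ℂ] L2} (hQ : IsSelfAdjoint Q) :
    IsSelfAdjoint (conjugatedOp a Q) := by
  have hsq : IsSelfAdjoint (besselOp * besselOp) := by
    simpa only [sq] using isSelfAdjoint_besselOp.pow 2
  have hreal : ∀ c : ℝ, IsSelfAdjoint (c : ℂ) := Complex.conj_ofReal
  exact (((hreal _).smul ((IsSelfAdjoint.one _).sub hsq)).add ((hreal _).smul hsq)).add hQ

lemma conjugatedOp_apply (a : ℝ) (Q : L2 →L[ℂ] L2) (h : L2) :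
    conjugatedOp a Q h = ((4 * π ^ 2 : ℝ) : ℂ) • (h - besselOp (besselOp h)) +
      ((a + 1 : ℝ) : ℂ) • besselOp (besselOp h) + Q h := rfl

lemma inner_conjugatedOp (ha : FormBound V a) {Q : L2 →L[ℂ] L2}
    (hQ : ∀ h k, inner ℂ h (Q k) = potentialForm ha h k) (h : L2) :
    inner ℂ h (conjugatedOp a Q h) =
      ((4 * π ^ 2 * (‖h‖ ^ 2 - ‖besselOp h‖ ^ 2) + (a + 1) * ‖besselOp h‖ ^ 2 +
        ∫ x, V x * ‖besselOp h x‖ ^ 2 : ℝ) : ℂ) := by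
  have hsq : inner ℂ h (besselOp (besselOp h)) = ((‖besselOp h‖ ^ 2 : ℝ) : ℂ) := by
    have hsymm := isSelfAdjoint_besselOp.isSymmetric h (besselOp h)
    rw [ContinuousLinearMap.coe_coe] at hsymm
    rw [← hsymm, inner_self_eq_norm_sq_to_K]
    norm_cast
  rw [conjugatedOp_apply, inner_add_right, inner_add_right, inner_smul_right, inner_smul_right,
    inner_sub_right, hsq, hQ, potentialForm_apply_self, inner_self_eq_norm_sq_to_K]
  push_cast
  rfl

lemma norm_sq_le_norm_inner_conjugatedOp (ha : FormBound V a) {Q : L2 →L[ℂ] L2}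
    (hQ : ∀ h k, inner ℂ h (Q k) = potentialForm ha h k) (h : L2) :
    ‖h‖ ^ 2 ≤ ‖inner ℂ h (conjugatedOp a Q h)‖ := by
  obtain ⟨g, hg⟩ := exists_hasGradient (besselOp_mem_H1 h)
  obtain ⟨-, hlower, -⟩ := ha _ (besselOp_mem_H1 h) g hg
  rw [hg.sum_norm_sq_besselOp] at hlower
  have hpi : 0 ≤ (2 * π ^ 2 - 1) * (‖h‖ ^ 2 - ‖besselOp h‖ ^ 2) := by
    have := pow_le_pow_left₀ (norm_nonneg _) (norm_besselOp_le h) 2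
    exact mul_nonneg (by nlinarith [Real.pi_gt_three]) (sub_nonneg.mpr this)
  rw [inner_conjugatedOp ha hQ, Complex.norm_real]
  refine le_trans ?_ (le_abs_self _)
  linarith

lemma isUnit_conjugatedOp (ha : FormBound V a) {Q : L2 →L[ℂ] L2}
    (hQ : ∀ h k, inner ℂ h (Q k) = potentialForm ha h k) : IsUnit (conjugatedOp a Q) := by
  refine ContinuousLinearMap.isUnit_of_forall_le_norm_inner_map _ one_pos fun h => ?_
  rw [NNReal.coe_one, mul_one, norm_inner_symm]
  exact norm_sq_le_norm_inner_conjugatedOp ha hQ h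

lemma shifted_besselOp (ha : FormBound V a) {Q : L2 →L[ℂ] L2}
    (hQ : ∀ h k, inner ℂ h (Q k) = potentialForm ha h k) (h : L2) :
    shifted V a (besselOp h) =
      TemperedDistribution.besselPotential R3 ℂ 1 (toDist (conjugatedOp a Q h)) := by
  have hpotential := (isRegular_potential_besselOp ha fun k => hQ k h).regular_eq
  rw [shifted, hamiltonian, neg_laplacian_toDist_besselOp, hpotential,
    ← besselPotential_one_toDist_besselOp (besselOp h), conjugatedOp_apply, toDist_add, toDist_add,
    toDist_smul _ (besselOp (besselOp h)), map_add, map_add, map_smul]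
  push_cast
  abel

theorem FormBound.exists_conjugatedOp (ha : FormBound V a) :
    ∃ B : L2 →L[ℂ] L2, IsUnit B ∧ IsSelfAdjoint B ∧ ∀ h, shifted V a (besselOp h) =
      TemperedDistribution.besselPotential R3 ℂ 1 (toDist (B h)) := by
  obtain ⟨Q, hQ, hform⟩ := exists_potentialOp ha
  exact ⟨conjugatedOp a Q, isUnit_conjugatedOp ha hform, isSelfAdjoint_conjugatedOp a hQ,
    shifted_besselOp ha hform⟩

theorem FormBound.bijOn_shifted (ha : FormBound V a) : BijOn (shifted V a) H1 Hneg1 := by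
  obtain ⟨B, hB, -, hshifted⟩ := ha.exists_conjugatedOp
  have hbij := ContinuousLinearMap.isUnit_iff_bijective.mp hB
  have hcomp : shifted V a ∘ besselOp =
      (fun h => TemperedDistribution.besselPotential R3 ℂ 1 (toDist h)) ∘ B := funext hshifted
  have himage : shifted V a '' H1 = Hneg1 := by
    rw [← range_besselOp, ← range_comp, hcomp, hbij.2.range_comp, range_besselPotential_one_toDist]
  have hinjOn : InjOn (shifted V a) H1 := by
    rw [← range_besselOp, ← image_univ]
    exact (hcomp ▸ besselPotential_one_toDist_injective.comp hbij.1).injOn.image_of_comp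
  exact himage ▸ hinjOn.bijOn_image

lemma FormBound.exists_isSelfAdjoint_shifted_eq_toDist (ha : FormBound V a) :
    ∃ K : L2 →L[ℂ] L2, IsSelfAdjoint K ∧ (∀ f, K f ∈ H1) ∧ ∀ f, shifted V a (K f) = toDist f := by
  obtain ⟨B, hunit, hB, hshifted⟩ := ha.exists_conjugatedOp
  have hinvertible := hunit.invertible
  have hinv (f : L2) : B (⅟B f) = f := by
    rw [← mul_apply_eq_comp, mul_invOf_self, one_apply_eq_self]
  refine ⟨besselOp * ⅟B * besselOp, ?_, fun f => besselOp_mem_H1 _, fun f => ?_⟩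
  · have hconj := ((IsSelfAdjoint.invOf_iff B).mpr hB).conjugate besselOp
    rwa [isSelfAdjoint_besselOp.star_eq] at hconj
  · rw [mul_apply_eq_comp, mul_apply_eq_comp, hshifted, hinv,
      besselPotential_one_toDist_besselOp]

theorem FormBound.exists_isSelfAdjoint (ha : FormBound V a) :
    ∃ A : L2 →ₗ.[ℂ] L2, (A.domain : Set L2) = h2 V a ∧
      (∀ u : A.domain, toDist (A u) = hamiltonian V (u : L2)) ∧ IsSelfAdjoint A := by
  obtain ⟨K, hK, hmem, hshifted⟩ := ha.exists_isSelfAdjoint_shifted_eq_toDist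
  have hinj : Function.Injective K := fun f g hfg =>
    toDist_injective (by rw [← hshifted, hfg, hshifted])
  obtain ⟨A, hdomain, hKA, hA⟩ := exists_isSelfAdjoint_inverse_sub hK.isSymmetric hinj (a + 1)
  refine ⟨A, ?_, fun u => ?_, hA⟩
  · rw [hdomain]
    ext u
    constructor
    · rintro ⟨f, rfl⟩
      exact ⟨hmem f, f, (hshifted f).symm⟩
    · rintro ⟨hu, f, hf⟩
      exact ⟨f, ha.bijOn_shifted.injOn (hmem f) hu ((hshifted f).trans hf)⟩
  · have hu := hshifted (A u + ((a + 1 : ℝ) : ℂ) • (u : L2))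
    have hKu : K (A u + ((a + 1 : ℝ) : ℂ) • (u : L2)) = u := hKA u
    rw [hKu, shifted, toDist_add, toDist_smul, Complex.ofReal_add,
      Complex.ofReal_one, add_left_inj] at hu
    exact hu.symm

end Hamiltonian

end

end Schrodinger

theorem lemma2p3 (V : Schrodinger.R3 → ℝ) (hV : Schrodinger.KatoClass V) :
    -- the quadratic form bound holds for all sufficiently large constants
    (∃ a₀ : ℝ, ∀ a : ℝ, a₀ ≤ a → Schrodinger.FormBound V a) ∧
    -- the product `V u` is a tempered distribution for `u` in `H¹`
    (∀ u ∈ Schrodinger.H1, Schrodinger.IsRegular (Schrodinger.potential V u)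
      (Schrodinger.regular (Schrodinger.potential V u))) ∧
    ∀ a : ℝ, Schrodinger.FormBound V a →
      -- `𝓗 + a + 1` is invertible from `H¹` onto `H⁻¹`
      Set.BijOn (Schrodinger.shifted V a) Schrodinger.H1 Schrodinger.Hneg1 ∧
      -- the operator `𝓗` in `L²` with domain `(𝓗 + a + 1)⁻¹(L²)` is self-adjoint
      ∃ A : Schrodinger.L2 →ₗ.[ℂ] Schrodinger.L2,
        (A.domain : Set Schrodinger.L2) = Schrodinger.h2 V a ∧
        (∀ u : A.domain, Schrodinger.toDist (A u) = Schrodinger.hamiltonian V (u : Schrodinger.L2)) ∧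
        IsSelfAdjoint A := by
  obtain ⟨a₀, ha₀⟩ := Filter.eventually_atTop.mp hV.eventually_formBound
  exact ⟨⟨a₀, ha₀⟩, fun u hu => (ha₀ a₀ le_rfl).isRegular_potential hu,
    fun a ha => ⟨ha.bijOn_shifted, ha.exists_isSelfAdjoint⟩⟩
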